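/- Let $G\subseteq\mathbb{R}^d$ with Borel $\sigma$-algebra $\mathcal{B}(G)$, let $\pi$ and $\nu$ be probability measures on $(G,\mathcal{B}(G))$, and let $K$ be a transition kernel on $(G,\mathcal{B}(G))$ that is reversible with respect to $\pi$, i.e. $\int_A K(x,B)\,\pi(dx)=\int_B K(x,A)\,\pi(dx)$ for all $A,B\in\mathcal{B}(G)$. Write $L_2=L_2(\pi)$ with norm $\|\cdot\|_2$, $L_2^0=\{f\in L_2:\int_G f\,d\pi=0\}$, $Pf(x)=\int_G f(y)\,K(x,dy)$ for the Markov operator of $K$, and \[ \Lambda=\sup\{\lambda\in\operatorname{spec}(P\mid L_2^0)\},\qquad \Lambda_0=\max\{0,\Lambda\} \] (with $\Lambda_0=0$ if $L_2^0=\{0\}$). Assume that $K$ is variance bounding, i.e. $\Lambda<1$, and that $\nu$ has a density $\frac{d\nu}{d\pi}\in L_2$ with respect to $\pi$. Let $\mathscr{A}\subseteq\mathcal{B}(G)$ be a set of test sets, and for every $\delta>0$ let $\Gamma_\delta\subseteq\mathcal{B}(G)$ be a $\delta$-cover of $\mathscr{A}$ with respect to $\pi$, that is, a finite set with $\emptyset\in\Gamma_\delta$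 such that for every $A\in\mathscr{A}$ there are $C,D\in\Gamma_\delta$ with $C\subseteq A\subseteq D$ and $\pi(D\setminus C)\le\delta$. Let $s\in\mathbb{N}$. Let $\varphi\colon G\times[0,1]^s\to G$ be any update function of $K$, i.e. a measurable function such that $K(x,A)=\mathbb{P}(\varphi(x;U)\in A)$ for all $x\in G$, $A\in\mathcal{B}(G)$, and let $\psi\colon[0,1]^s\to G$ be any generator function of $\nu$, i.e. a measurable function such that $\nu(A)=\mathbb{P}(\psi(U)\in A)$ for all $A\in\mathcal{B}(G)$, where $U$ is uniformly distributed on $[0,1]^s$. Then for every $n\ge 1$ and every $\delta>0$ there exists a driver sequence $u_0,\dots,u_{n-1}\in[0,1]^s$ such that the points $S_n=\{x_1,\dots,x_n\}$ (counted with multiplicity) given by $x_1=\psi(u_0)$ and $x_{i+1}=\varphi(x_i;u_i)$, $i=1,\dots,n-1$, satisfy \[ D^*_{\mathscr{A},\pi}(S_n):=\sup_{A\in\mathscr{A}}\Bigl|\frac1n\sum_{i=1}^n 1_{x_i\in A}-\pi(A)\Bigr| \le\sqrt{\frac{1+\Lambda_0}{1-\Lambda_0}}\cdot\frac{\sqrt{2\log\bigl(|\Gamma_\delta|^2\,\|\frac{d\nu}{d\pi}\|_2\bigr)}}{\sqrt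 n}+\delta . \] -/

import Mathlib

open MeasureTheory ProbabilityTheory
open scoped ENNReal

namespace MCQMC

noncomputable section

section MarkovOperator

variable {G : Type*} [MeasurableSpace G] {K : Kernel G G} {π : Measure G}

/-- The action `(P f)(x) = ∫ f(y) K(x, dy)` of a transition kernel on functions. -/
def kernelMean (K : Kernel G G) (f : G → ℝ) (x : G) : ℝ := ∫ y, f y ∂(K x)

theorem kernelMean_congr (hK : K.Invariant π) {f g : G → ℝ} (h : f =ᵐ[π] g) :
    kernelMean K f =ᵐ[π] kernelMean K g := by
  have h' : ∀ᵐ y ∂(π.bind K), f y = g y := by rw [hK.def]; exact h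
  filter_upwards [Measure.ae_ae_of_ae_comp h'] with x hx
  exact integral_congr_ae hx

theorem ae_integrable_kernel (hK : K.Invariant π) {f : G → ℝ} (hf : Integrable f π) :
    ∀ᵐ x ∂π, Integrable f (K x) := by
  have h' : Integrable f (π.bind K) := by rw [hK.def]; exact hf
  exact Measure.ae_integrable_of_integrable_comp h'

theorem stronglyMeasurable_kernelMean {f : G → ℝ} [IsMarkovKernel K]
    (hf : StronglyMeasurable f) : StronglyMeasurable (kernelMean K f) :=
  hf.integral_kernel

theorem eLpNorm_kernelMean_le [IsMarkovKernel K] (hK : K.Invariant π) {f : G → ℝ}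
    (hf : StronglyMeasurable f) : eLpNorm (kernelMean K f) 2 π ≤ eLpNorm f 2 π := by
  have key : ∀ x, ‖kernelMean K f x‖ₑ ^ (2 : ℝ) ≤ ∫⁻ y, ‖f y‖ₑ ^ (2 : ℝ) ∂(K x) := by
    intro x
    have h1 : ‖kernelMean K f x‖ₑ ≤ ∫⁻ y, ‖f y‖ₑ ∂(K x) := enorm_integral_le_lintegral_enorm _
    have h2 := eLpNorm_le_eLpNorm_of_exponent_le (μ := K x) (p := 1) (q := 2) (by norm_num)
      hf.aestronglyMeasurable
    rw [eLpNorm_one_eq_lintegral_enorm,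
      eLpNorm_eq_lintegral_rpow_enorm_toReal (by norm_num) (by norm_num)] at h2
    have h3 := ENNReal.rpow_le_rpow (h1.trans h2) (z := 2) (by norm_num)
    refine h3.trans (le_of_eq ?_)
    rw [← ENNReal.rpow_mul]
    norm_num
  rw [eLpNorm_eq_lintegral_rpow_enorm_toReal (by norm_num) (by norm_num),
    eLpNorm_eq_lintegral_rpow_enorm_toReal (by norm_num) (by norm_num)]
  refine ENNReal.rpow_le_rpow ?_ (by norm_num)
  simp only [ENNReal.toReal_ofNat]
  calc ∫⁻ x, ‖kernelMean K f x‖ₑ ^ (2 : ℝ) ∂π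
      ≤ ∫⁻ x, ∫⁻ y, ‖f y‖ₑ ^ (2 : ℝ) ∂(K x) ∂π := lintegral_mono key
    _ = ∫⁻ y, ‖f y‖ₑ ^ (2 : ℝ) ∂(π.bind K) :=
        (Measure.lintegral_bind K.aemeasurable
          (hf.enorm.pow_const _).aemeasurable).symm
    _ = ∫⁻ y, ‖f y‖ₑ ^ (2 : ℝ) ∂π := by rw [hK.def]

theorem memLp_kernelMean [IsMarkovKernel K] (hK : K.Invariant π) (f : Lp ℝ 2 π) :
    MemLp (kernelMean K f) 2 π :=
  ⟨(stronglyMeasurable_kernelMean (Lp.stronglyMeasurable f)).aestronglyMeasurable,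
    (eLpNorm_kernelMean_le hK (Lp.stronglyMeasurable f)).trans_lt (Lp.memLp f).2⟩

variable [IsProbabilityMeasure π]

/-- The Markov operator `P : L₂(π) → L₂(π)`, `(P f)(x) = ∫ f(y) K(x, dy)`, of a transition
kernel `K` with stationary distribution `π`. -/
def markovOperator (K : Kernel G G) [IsMarkovKernel K] (hK : K.Invariant π) :
    Lp ℝ 2 π →L[ℝ] Lp ℝ 2 π :=
  LinearMap.mkContinuous
    { toFun := fun f => (memLp_kernelMean hK f).toLp (kernelMean K f)
      map_add' := by
        intro f g
        rw [← MemLp.toLp_add]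
        refine MemLp.toLp_congr _ _ ((kernelMean_congr hK (Lp.coeFn_add f g)).trans ?_)
        filter_upwards [ae_integrable_kernel hK ((Lp.memLp f).integrable (by norm_num)),
          ae_integrable_kernel hK ((Lp.memLp g).integrable (by norm_num))] with x hf hg
        exact integral_add hf hg
      map_smul' := by
        intro c f
        rw [RingHom.id_apply, ← MemLp.toLp_const_smul]
        refine MemLp.toLp_congr _ _ ((kernelMean_congr hK (Lp.coeFn_smul c f)).trans ?_)
        filter_upwards with x
        exact integral_smul c _ }
    1 (by
      intro f
      rw [one_mul, LinearMap.coe_mk, AddHom.coe_mk, Lp.norm_toLp, Lp.norm_def]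
      exact ENNReal.toReal_mono (Lp.memLp f).2.ne
        (eLpNorm_kernelMean_le hK (Lp.stronglyMeasurable f)))

theorem coeFn_markovOperator (K : Kernel G G) [IsMarkovKernel K] (hK : K.Invariant π)
    (f : Lp ℝ 2 π) : markovOperator K hK f =ᵐ[π] kernelMean K f :=
  MemLp.coeFn_toLp (memLp_kernelMean hK f)

/-- The closed subspace `L₂⁰(π)` of all `f ∈ L₂(π)` with `∫ f dπ = 0`. -/
def meanZero (π : Measure G) [IsProbabilityMeasure π] : Submodule ℝ (Lp ℝ 2 π) where
  carrier := {f | ∫ x, f x ∂π = 0}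
  add_mem' := by
    intro f g hf hg
    rw [Set.mem_ofPred_eq] at hf hg ⊢
    rw [integral_congr_ae (Lp.coeFn_add f g)]
    have := integral_add ((Lp.memLp f).integrable (by norm_num))
      ((Lp.memLp g).integrable (by norm_num))
    simp only [Pi.add_apply]
    rw [this, hf, hg, add_zero]
  zero_mem' := by
    rw [Set.mem_ofPred_eq, integral_congr_ae (Lp.coeFn_zero ℝ 2 π)]
    simp
  smul_mem' := by
    intro c f hf
    rw [Set.mem_ofPred_eq] at hf ⊢
    rw [integral_congr_ae (Lp.coeFn_smul c f)]
    simp only [Pi.smul_apply]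
    rw [integral_smul, hf, smul_zero]

theorem markovOperator_mem_meanZero (K : Kernel G G) [IsMarkovKernel K] (hK : K.Invariant π) :
    ∀ f ∈ meanZero π, markovOperator K hK f ∈ meanZero π := by
  intro f hf
  have hf0 : ∫ x, f x ∂π = 0 := hf
  have hi : Integrable f ((K ∘ₖ Kernel.const Unit π) ()) := by
    rw [← Measure.comp_eq_comp_const_apply, hK.def]
    exact (Lp.memLp f).integrable (by norm_num)
  change ∫ x, markovOperator K hK f x ∂π = 0
  rw [integral_congr_ae (coeFn_markovOperator K hK f)]
  have := Kernel.integral_comp hi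
  rw [← Measure.comp_eq_comp_const_apply, hK.def, Kernel.const_apply] at this
  rw [← hf0, this]
  rfl

/-- The Markov operator restricted to `L₂⁰(π)`. -/
def markovOperatorZero (K : Kernel G G) [IsMarkovKernel K] (hK : K.Invariant π) :
    meanZero π →L[ℝ] meanZero π :=
  (markovOperator K hK).restrict (markovOperator_mem_meanZero K hK)

/-- `Λ = sup spec(P | L₂⁰)` for a reversible kernel. The operator is self-adjoint and of norm at
most one, so its spectrum is real and compact. It is empty only if `L₂⁰ = 0`, in which case the
real supremum is `0`; this does not affect `Λ < 1` or `max 0 Λ`. -/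
def spectralSup (K : Kernel G G) [IsMarkovKernel K] (hrev : K.IsReversible π) : ℝ :=
  sSup (spectrum ℝ (markovOperatorZero K hrev.invariant))

/-- A reversible kernel is variance bounding (has an `L₂`-spectral gap) if `Λ < 1`. -/
def IsVarianceBounding (K : Kernel G G) [IsMarkovKernel K] (hrev : K.IsReversible π) : Prop :=
  spectralSup K hrev < 1

end MarkovOperator

section Driver

variable {G : Type*} [MeasurableSpace G]

/-- The cube `[0,1]^s`; its `volume` is the uniform distribution. -/
abbrev Cube (s : ℕ) : Type := Fin s → unitInterval

/-- `φ` is an update function of `K`: it is jointly measurable and `K(x, A) = ℙ(φ(x; U) ∈ A)`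
for `U` uniform on `[0,1]^s`. -/
def IsUpdateFunction {s : ℕ} (K : Kernel G G) (φ : G → Cube s → G) : Prop :=
  Measurable (Function.uncurry φ) ∧
    ∀ (x : G) (A : Set G), MeasurableSet A → K x A = volume {u : Cube s | φ x u ∈ A}

/-- `ψ` is a generator function of `ν`: it is measurable and `ν(A) = ℙ(ψ(U) ∈ A)` for `U`
uniform on `[0,1]^s`. -/
def IsGeneratorFunction {s : ℕ} (ν : Measure G) (ψ : Cube s → G) : Prop :=
  Measurable ψ ∧ ∀ A : Set G, MeasurableSet A → ν A = volume {u : Cube s | ψ u ∈ A}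

/-- The point `x_{i+1}` driven by `u_0, …, u_{n-1}`, where `x_1 = ψ(u_0)` and
`x_{i+1} = φ(x_i; u_i)`. -/
def drivenPoint {s n : ℕ} (φ : G → Cube s → G) (ψ : Cube s → G) (u : Fin n → Cube s) :
    (i : ℕ) → i < n → G
  | 0, h => ψ (u ⟨0, h⟩)
  | i + 1, h => φ (drivenPoint φ ψ u i (Nat.lt_of_succ_lt h)) (u ⟨i + 1, h⟩)

/-- The points `S_n = (x_1, …, x_n)`, indexed from `0`. -/
def drivenPoints {s n : ℕ} (φ : G → Cube s → G) (ψ : Cube s → G) (u : Fin n → Cube s) :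
    Fin n → G :=
  fun i => drivenPoint φ ψ u i i.isLt

/-- The star-discrepancy
`sup_{A ∈ 𝒜} |(1/n) ∑ᵢ 1_{xᵢ ∈ A} - π(A)|` of a finite sequence of points. -/
def starDiscrepancy {n : ℕ} (𝒜 : Set (Set G)) (π : Measure G) (x : Fin n → G) : ℝ :=
  ⨆ A : 𝒜, |(1 / (n : ℝ)) * ∑ i, (A : Set G).indicator (fun _ => (1 : ℝ)) (x i) - π.real A|

/-- A finite set `Γ` of measurable sets, containing `∅`, is a `δ`-cover of `𝒜` with respect to
`π` if every `A ∈ 𝒜` lies between two members of `Γ` whose difference has measure at most `δ`. -/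
def IsDeltaCover (𝒜 : Set (Set G)) (π : Measure G) (δ : ℝ) (Γ : Finset (Set G)) : Prop :=
  (∀ C ∈ Γ, MeasurableSet C) ∧ ∅ ∈ Γ ∧
    ∀ A ∈ 𝒜, ∃ C ∈ Γ, ∃ D ∈ Γ, C ⊆ A ∧ A ⊆ D ∧ π.real (D \ C) ≤ δ

/-- The density `dν/dπ` as a real-valued function. -/
def density (ν π : Measure G) : G → ℝ := fun x => (ν.rnDeriv π x).toReal

end Driver

end

end MCQMC

/-! The driver sequence is found by the probabilistic method. For independent uniform drivers the
points form a Markov chain with kernel `K` and initial law `ν`, so a Hoeffding bound for each cover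
set and a union bound leave a driver that is good for the whole cover; the cover property then costs
a further δ.

The Hoeffding bound rests on exponential moments of occupation times. Put l = Λ₀ and κ =
(1+l)/(1-l). The spectral bound makes the quadratic form of P at most that of the kernel that stays
put with probability l and otherwise samples from π. For w = exp((2m/κ)(1_C - π(C))), the latter
form is at most R∫H²/w, with R = exp(m²/κ), as soon as (1-l)∫(R/w - l)⁻¹ dπ ≤ 1 and R/w > l
(`rankOne_form_le`). As w takes two values, this is a scalar inequality (`two_point_inequality`).
Since |PH| ≤ P|H|, the bound on the form is two-sided and polarizes to an operator bound
(`integral_mul_kernelMean_sq_le`). Iterating it bounds the stationary moment of w(X₁)⋯w(Xₙ) by Rⁿ.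

A start in `ν` is handled by Cauchy-Schwarz, which gives the factor ‖dν/dπ‖₂ and doubles the
exponent; this is why the tilt is 2m/κ. -/

namespace MCQMC

/-! ### Quadratic forms and the top of the spectrum. -/

section SpectralBound

open scoped InnerProductSpace

variable {H : Type*} [NormedAddCommGroup H] [InnerProductSpace ℝ H]

/-- Expand the nonnegative form at (‖B‖ + 1)y - By. The summand 1 keeps the factor that is divided
out positive even when B = 0. -/
theorem norm_sq_apply_le_of_nonneg_inner (B : H →L[ℝ] H) (hB : ∀ x y, ⟪B x, y⟫_ℝ = ⟪x, B y⟫_ℝ)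
    (hpos : ∀ x, 0 ≤ ⟪B x, x⟫_ℝ) (y : H) : ‖B y‖ ^ 2 ≤ (‖B‖ + 1) * ⟪B y, y⟫_ℝ := by
  have hb : 0 < ‖B‖ + 1 := by positivity
  have h1 := hpos ((‖B‖ + 1) • y - B y)
  have h2 : ⟪B (B y), B y⟫_ℝ ≤ ‖B‖ * ‖B y‖ ^ 2 := by
    refine (real_inner_le_norm _ _).trans ?_
    rw [pow_two, ← mul_assoc]
    exact mul_le_mul_of_nonneg_right (B.le_opNorm _) (norm_nonneg _)
  have h3 : ⟪B ((‖B‖ + 1) • y - B y), (‖B‖ + 1) • y - B y⟫_ℝ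
      = (‖B‖ + 1) ^ 2 * ⟪B y, y⟫_ℝ - 2 * (‖B‖ + 1) * ‖B y‖ ^ 2 + ⟪B (B y), B y⟫_ℝ := by
    rw [map_sub, map_smul, inner_sub_left, inner_sub_right, inner_sub_right]
    simp only [real_inner_smul_left, real_inner_smul_right]
    rw [hB (B y) y, real_inner_self_eq_norm_sq]
    ring
  rw [h3] at h1
  have h4 : 0 ≤ (‖B‖ + 1) * ((‖B‖ + 1) * ⟪B y, y⟫_ℝ - ‖B y‖ ^ 2) := by
    nlinarith [sq_nonneg ‖B y‖]
  linarith [nonneg_of_mul_nonneg_right h4 hb]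

/-- The quadratic form of a bounded symmetric operator on a real Hilbert space is bounded by the
supremum of the spectrum. -/
theorem inner_apply_self_le_sSup_spectrum [CompleteSpace H] (A : H →L[ℝ] H)
    (hA : ∀ x y, ⟪A x, y⟫_ℝ = ⟪x, A y⟫_ℝ) (x : H) :
    ⟪A x, x⟫_ℝ ≤ sSup (spectrum ℝ A) * ‖x‖ ^ 2 := by
  by_cases hx : x = 0
  · simp [hx]
  have hxn : 0 < ‖x‖ := norm_pos_iff.mpr hx
  set S : Set ℝ := {r | ∃ y : H, ‖y‖ = 1 ∧ ⟪A y, y⟫_ℝ = r} with hS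
  have hScale : ∀ y : H, y ≠ 0 → ⟪A y, y⟫_ℝ / ‖y‖ ^ 2 ∈ S := by
    intro y hy
    have hyn : ‖y‖ ≠ 0 := norm_ne_zero_iff.mpr hy
    refine ⟨‖y‖⁻¹ • y, ?_, ?_⟩
    · rw [norm_smul, norm_inv, norm_norm, inv_mul_cancel₀ hyn]
    · rw [map_smul, real_inner_smul_left, real_inner_smul_right]
      field_simp
  have hbdd : BddAbove S := by
    refine ⟨‖A‖, ?_⟩
    rintro r ⟨y, hy, rfl⟩
    refine (real_inner_le_norm _ _).trans ?_
    have := A.le_opNorm y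
    rw [hy, mul_one] at *
    exact this
  set μ := sSup S with hμ
  have hle : ∀ y : H, ⟪A y, y⟫_ℝ ≤ μ * ‖y‖ ^ 2 := by
    intro y
    by_cases hy : y = 0
    · simp [hy]
    · have hyn : 0 < ‖y‖ := norm_pos_iff.mpr hy
      exact (div_le_iff₀ (by positivity)).mp (le_csSup hbdd (hScale y hy))
  -- The supremum μ of the numerical range is spectral: otherwise B = μ - A is bounded below, hence
  -- so is its nonnegative form on unit vectors, and the numerical range stays a fixed distance
  -- below μ.
  have hmem : μ ∈ spectrum ℝ A := by
    rw [spectrum.mem_iff]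
    intro hu
    obtain ⟨C, hC⟩ := hu.exists_left_inv
    set B : H →L[ℝ] H := algebraMap ℝ (H →L[ℝ] H) μ - A with hBdef
    have hBapp : ∀ y, B y = μ • y - A y := by
      intro y
      simp [hBdef, Algebra.algebraMap_eq_smul_one]
    have hBinner : ∀ y, ⟪B y, y⟫_ℝ = μ * ‖y‖ ^ 2 - ⟪A y, y⟫_ℝ := by
      intro y
      rw [hBapp, inner_sub_left, real_inner_smul_left, real_inner_self_eq_norm_sq]
    have hkey := norm_sq_apply_le_of_nonneg_inner B
      (by
        intro y z
        rw [hBapp, hBapp, inner_sub_left, inner_sub_right, real_inner_smul_left,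
          real_inner_smul_right, hA])
      (by intro y; rw [hBinner]; linarith [hle y])
    have hub : ∀ r ∈ S, r ≤ μ - 1 / (‖C‖ ^ 2 * (‖B‖ + 1)) := by
      rintro r ⟨y, hy, rfl⟩
      have h1 : ‖y‖ ≤ ‖C‖ * ‖B y‖ := by
        have : C (B y) = y := by
          have := congrArg (fun T : H →L[ℝ] H => T y) hC
          simpa using this
        calc ‖y‖ = ‖C (B y)‖ := by rw [this]
          _ ≤ _ := C.le_opNorm _
      have hCpos : 0 < ‖C‖ := by
        rcases (norm_nonneg C).eq_or_lt with h | h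
        · rw [← h, hy] at h1; norm_num at h1
        · exact h
      have h2 : 1 ≤ ‖C‖ ^ 2 * ‖B y‖ ^ 2 := by
        rw [hy] at h1
        rw [← mul_pow]
        exact one_le_pow₀ h1
      have h3 := hkey y
      rw [hBinner, hy] at h3
      have h4 : 1 ≤ (‖C‖ ^ 2 * (‖B‖ + 1)) * (μ - ⟪A y, y⟫_ℝ) := by
        refine h2.trans ?_
        rw [mul_assoc]
        refine mul_le_mul_of_nonneg_left ?_ (by positivity)
        simpa using h3
      have h5 : 1 / (‖C‖ ^ 2 * (‖B‖ + 1)) ≤ μ - ⟪A y, y⟫_ℝ := by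
        rw [div_le_iff₀ (by positivity)]
        linarith
      linarith
    have h6 := csSup_le ⟨_, hScale x hx⟩ hub
    have hCpos : C ≠ 0 := by
      rintro rfl
      have h7 : (0 : H →L[ℝ] H) = 1 := by simpa using hC
      have := congrArg (fun T : H →L[ℝ] H => T x) h7
      exact hx (by simpa using this.symm)
    have : 0 < 1 / (‖C‖ ^ 2 * (‖B‖ + 1)) := by
      have := norm_pos_iff.mpr hCpos
      positivity
    linarith
  have hsp : μ ≤ sSup (spectrum ℝ A) := le_csSup (spectrum.isBounded A).bddAbove hmem
  exact (hle x).trans (mul_le_mul_of_nonneg_right hsp (by positivity))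

end SpectralBound

/-! ### The scalar inequality for a two-valued weight. -/

section TwoPoint

theorem sinh_le_mul_cosh {x : ℝ} (hx : 0 ≤ x) : Real.sinh x ≤ x * Real.cosh x := by
  have hd : ∀ y : ℝ, HasDerivAt (fun y => y * Real.cosh y - Real.sinh y) (y * Real.sinh y) y := by
    intro y
    refine (((hasDerivAt_id y).mul (Real.hasDerivAt_cosh y)).sub
      (Real.hasDerivAt_sinh y)).congr_deriv ?_
    simp
  have hm : MonotoneOn (fun y => y * Real.cosh y - Real.sinh y) (Set.Ici 0) := by
    refine monotoneOn_of_deriv_nonneg (convex_Ici 0)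
      (fun y _ => (hd y).continuousAt.continuousWithinAt)
      (fun y _ => (hd y).differentiableAt.differentiableWithinAt) ?_
    intro y hy
    rw [interior_Ici] at hy
    rw [(hd y).deriv]
    exact mul_nonneg (le_of_lt hy) (Real.sinh_nonneg_iff.mpr (le_of_lt hy))
  have := hm (Set.mem_Ici.mpr le_rfl) (Set.mem_Ici.mpr hx) hx
  simp only [Real.cosh_zero, Real.sinh_zero] at this
  linarith

theorem mul_cosh_le_sinh {x : ℝ} (hx : 0 ≤ x) :
    (x - x ^ 3 / 3) * Real.cosh x ≤ Real.sinh x := by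
  have hd : ∀ y : ℝ, HasDerivAt (fun y => Real.sinh y - (y - y ^ 3 / 3) * Real.cosh y)
      (y * (y * Real.cosh y - Real.sinh y) + y ^ 3 / 3 * Real.sinh y) y := by
    intro y
    refine ((Real.hasDerivAt_sinh y).sub (((hasDerivAt_id y).sub
      (((hasDerivAt_id y).pow 3).div_const 3)).mul (Real.hasDerivAt_cosh y))).congr_deriv ?_
    simp
    ring
  have hm : MonotoneOn (fun y => Real.sinh y - (y - y ^ 3 / 3) * Real.cosh y) (Set.Ici 0) := by
    refine monotoneOn_of_deriv_nonneg (convex_Ici 0)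
      (fun y _ => (hd y).continuousAt.continuousWithinAt)
      (fun y _ => (hd y).differentiableAt.differentiableWithinAt) ?_
    intro y hy
    rw [interior_Ici] at hy
    have hy' : 0 ≤ y := le_of_lt hy
    rw [(hd y).deriv]
    have h1 := sinh_le_mul_cosh hy'
    have h2 := Real.sinh_nonneg_iff.mpr hy'
    have h3 : 0 ≤ y * Real.cosh y - Real.sinh y := by linarith
    positivity
  have := hm (Set.mem_Ici.mpr le_rfl) (Set.mem_Ici.mpr hx) hx
  simp only [Real.cosh_zero, Real.sinh_zero] at this
  linarith

theorem tanh_le_self {x : ℝ} (hx : 0 ≤ x) : Real.tanh x ≤ x := by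
  rw [Real.tanh_eq_sinh_div_cosh, div_le_iff₀ (Real.cosh_pos x)]
  exact sinh_le_mul_cosh hx

theorem self_sub_cube_le_tanh {x : ℝ} (hx : 0 ≤ x) : x - x ^ 3 / 3 ≤ Real.tanh x := by
  rw [Real.tanh_eq_sinh_div_cosh, le_div_iff₀ (Real.cosh_pos x)]
  exact mul_cosh_le_sinh hx

theorem exp_two_mul_eq_tanh (x : ℝ) :
    Real.exp (2 * x) = (1 + Real.tanh x) / (1 - Real.tanh x) := by
  have h1 := Real.cosh_pos x
  have h2 := Real.exp_pos (-x)
  have h3 : Real.cosh x - Real.sinh x = Real.exp (-x) := Real.cosh_sub_sinh x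
  have h4 : Real.cosh x + Real.sinh x = Real.exp x := Real.cosh_add_sinh x
  have h5 : 1 - Real.tanh x = Real.exp (-x) / Real.cosh x := by
    rw [Real.tanh_eq_sinh_div_cosh, ← h3]; field_simp
  have h6 : 1 + Real.tanh x = Real.exp x / Real.cosh x := by
    rw [Real.tanh_eq_sinh_div_cosh, ← h4]; field_simp
  rw [h5, h6, div_div_div_cancel_right₀ h1.ne', ← Real.exp_sub]
  ring_nf

/-- Write a = qm - m²/2 and b = pm + m²/2, so a + b = m. Since 2b ≤ 3 and q - a ≤ 1, the cubic term
costs at most b²/2; what then remains is exactly a²/2 ≥ 0. -/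
theorem two_point_polynomial {p q m : ℝ} (hp : 0 ≤ p) (hq : 0 ≤ q) (hpq : p + q = 1)
    (hm : 0 ≤ m) (hm1 : m ≤ 1) :
    p * (q * m - m ^ 2 / 2) ≤ (q - (q * m - m ^ 2 / 2)) *
      ((p * m + m ^ 2 / 2) * (1 - (p * m + m ^ 2 / 2) ^ 2 / 3)) := by
  obtain rfl : q = 1 - p := by linarith
  have h1 : 0 ≤ (1 - p) * (1 - m) := mul_nonneg hq (by linarith)
  have hqa : 1 - p - ((1 - p) * m - m ^ 2 / 2) ≤ 1 := by
    have : 0 ≤ m * (1 - m) := mul_nonneg hm (by linarith)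
    linarith [mul_nonneg hp (by linarith : 0 ≤ 1 - m)]
  have hv0 : 0 ≤ 2 * p + m := by positivity
  have hmv : m * (2 * p + m) ≤ 3 :=
    (mul_le_of_le_one_left hv0 hm1).trans (by linarith)
  have e2 : (1 - p - ((1 - p) * m - m ^ 2 / 2)) * ((m * (2 * p + m)) ^ 3 / 24) ≤
      (m * (2 * p + m)) ^ 3 / 24 := mul_le_of_le_one_left (by positivity) hqa
  have e3 := mul_le_mul_of_nonneg_left hmv (sq_nonneg (m * (2 * p + m)))
  have e4 := mul_nonneg (sq_nonneg m) (sq_nonneg (2 * p + m - 2))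
  linarith

/-- This is `two_point_inequality` with its exponentials written through tanh and its denominators
cleared. -/
theorem two_point_tanh {p q m κ : ℝ} (hp : 0 ≤ p) (hq : 0 ≤ q) (hpq : p + q = 1)
    (hm : 0 ≤ m) (hm1 : m ≤ 1) (hκ : 1 ≤ κ) :
    κ * Real.tanh ((q * m - m ^ 2 / 2) / κ) < 1 ∧
    p * Real.tanh ((q * m - m ^ 2 / 2) / κ) * (1 + κ * Real.tanh ((p * m + m ^ 2 / 2) / κ)) ≤
      q * Real.tanh ((p * m + m ^ 2 / 2) / κ) *
        (1 - κ * Real.tanh ((q * m - m ^ 2 / 2) / κ)) := by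
  have hκ0 : 0 < κ := by linarith
  set b := p * m + m ^ 2 / 2 with hb
  set a := q * m - m ^ 2 / 2 with ha
  have hb0 : 0 ≤ b := by positivity
  have hbκ : 0 ≤ b / κ := by positivity
  have hx : 0 ≤ Real.tanh (b / κ) := by
    rw [Real.tanh_eq_sinh_div_cosh]
    exact div_nonneg (Real.sinh_nonneg_iff.mpr hbκ) (Real.cosh_pos _).le
  -- For a ≤ 0 the two sides have opposite signs; only a ≥ 0 needs the polynomial.
  rcases le_total a 0 with h | h
  · have hT : Real.tanh (a / κ) ≤ 0 := by
      rw [Real.tanh_eq_sinh_div_cosh]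
      refine div_nonpos_of_nonpos_of_nonneg (Real.sinh_nonpos_iff.mpr ?_) (Real.cosh_pos _).le
      exact div_nonpos_of_nonpos_of_nonneg h hκ0.le
    have hκT : κ * Real.tanh (a / κ) ≤ 0 := mul_nonpos_of_nonneg_of_nonpos hκ0.le hT
    refine ⟨by linarith, ?_⟩
    have h1 : p * Real.tanh (a / κ) * (1 + κ * Real.tanh (b / κ)) ≤ 0 :=
      mul_nonpos_of_nonpos_of_nonneg (mul_nonpos_of_nonneg_of_nonpos hp hT) (by positivity)
    have h2 : 0 ≤ q * Real.tanh (b / κ) * (1 - κ * Real.tanh (a / κ)) :=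
      mul_nonneg (mul_nonneg hq hx) (by linarith)
    linarith
  · have haκ : 0 ≤ a / κ := by positivity
    have hT : κ * Real.tanh (a / κ) ≤ a := by
      have := mul_le_mul_of_nonneg_left (tanh_le_self haκ) hκ0.le
      rwa [mul_div_cancel₀ _ hκ0.ne'] at this
    -- Here κ ≥ 1 removes κ: the cubic error is divided by κ² and is largest at κ = 1.
    have ht : b * (1 - b ^ 2 / 3) ≤ κ * Real.tanh (b / κ) := by
      have h1 := mul_le_mul_of_nonneg_left (self_sub_cube_le_tanh hbκ) hκ0.le
      refine le_trans ?_ h1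
      have h2 : κ * (b / κ - (b / κ) ^ 3 / 3) = b * (1 - b ^ 2 / 3 / κ ^ 2) := by
        field_simp
      rw [h2]
      refine mul_le_mul_of_nonneg_left ?_ hb0
      have : b ^ 2 / 3 / κ ^ 2 ≤ b ^ 2 / 3 := div_le_self (by positivity) (one_le_pow₀ hκ)
      linarith
    have hq1 : q ≤ 1 := by linarith
    have ha1 : a ≤ q * m := by rw [ha]; nlinarith
    have haq : a ≤ q := by nlinarith
    have ha2 : a ≤ 1 / 2 := by rw [ha]; nlinarith [sq_nonneg (m - 1)]
    have hpoly : p * a ≤ (q - a) * (b * (1 - b ^ 2 / 3)) := by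
      rw [ha, hb]
      exact two_point_polynomial hp hq hpq hm hm1
    refine ⟨by linarith, ?_⟩
    set T := κ * Real.tanh (a / κ) with hTdef
    set t := κ * Real.tanh (b / κ) with htdef
    have h5 : p * T ≤ (q - T) * t := by
      calc p * T ≤ p * a := mul_le_mul_of_nonneg_left hT hp
        _ ≤ (q - a) * (b * (1 - b ^ 2 / 3)) := hpoly
        _ ≤ (q - a) * t := mul_le_mul_of_nonneg_left ht (by linarith)
        _ ≤ (q - T) * t := mul_le_mul_of_nonneg_right (by linarith) (by positivity)
    have h6 : κ * (p * Real.tanh (a / κ) * (1 + t)) ≤ κ * (q * Real.tanh (b / κ) * (1 - T)) := by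
      have e1 : κ * (p * Real.tanh (a / κ) * (1 + t)) = p * T * (1 + t) := by rw [hTdef]; ring
      have e2 : κ * (q * Real.tanh (b / κ) * (1 - T)) = q * t * (1 - T) := by rw [htdef]; ring
      rw [e1, e2]
      have : p = 1 - q := by linarith
      subst this
      nlinarith
    exact le_of_mul_le_mul_left h6 hκ0

/-- The two-point inequality that controls the exponential moments of the indicator of a set of
probability `p` along a chain with spectral gap `1 - l`. -/
theorem two_point_inequality {p q m l : ℝ} (hp : 0 ≤ p) (hq : 0 ≤ q) (hpq : p + q = 1)
    (hm : 0 ≤ m) (hm1 : m ≤ 1) (hl : 0 ≤ l) (hl1 : l < 1) {κ : ℝ} (hκ : κ = (1 + l) / (1 - l)) :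
    l * Real.exp (2 * m / κ * q) < Real.exp (m ^ 2 / κ) ∧
    l * Real.exp (2 * m / κ * (-p)) < Real.exp (m ^ 2 / κ) ∧
    (1 - l) * (p * (Real.exp (m ^ 2 / κ) / Real.exp (2 * m / κ * q) - l)⁻¹ +
      q * (Real.exp (m ^ 2 / κ) / Real.exp (2 * m / κ * (-p)) - l)⁻¹) ≤ 1 := by
  have hl' : 0 < 1 - l := by linarith
  have hκ1 : 1 ≤ κ := by rw [hκ, le_div_iff₀ hl']; linarith
  have hκ0 : 0 < κ := by linarith
  obtain ⟨h1, h2⟩ := two_point_tanh hp hq hpq hm hm1 hκ1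
  set T := Real.tanh ((q * m - m ^ 2 / 2) / κ) with hT
  set t := Real.tanh ((p * m + m ^ 2 / 2) / κ) with ht
  have hT1 : T < 1 := Real.tanh_lt_one _
  have ht0 : 0 ≤ t := by
    rw [ht, Real.tanh_eq_sinh_div_cosh]
    exact div_nonneg (Real.sinh_nonneg_iff.mpr (by positivity)) (Real.cosh_pos _).le
  have ht1 : t < 1 := Real.tanh_lt_one _
  have hX : Real.exp (m ^ 2 / κ) / Real.exp (2 * m / κ * q) = (1 - T) / (1 + T) := by
    have := exp_two_mul_eq_tanh ((q * m - m ^ 2 / 2) / κ)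
    rw [← hT] at this
    rw [← inv_div (1 + T), ← this, ← Real.exp_neg, ← Real.exp_sub]
    congr 1
    field_simp
    ring
  have hY : Real.exp (m ^ 2 / κ) / Real.exp (2 * m / κ * (-p)) = (1 + t) / (1 - t) := by
    have := exp_two_mul_eq_tanh ((p * m + m ^ 2 / 2) / κ)
    rw [← ht] at this
    rw [← this, ← Real.exp_sub]
    congr 1
    field_simp
    ring
  have hTm : -1 < T := Real.neg_one_lt_tanh _
  -- The value of κ is forced here: (1-T) - l(1+T) = (1-l)(1-κT).
  have hXl : (1 - T) / (1 + T) - l = (1 - l) * (1 - κ * T) / (1 + T) := by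
    have : 1 + T ≠ 0 := by linarith
    rw [hκ]
    field_simp
    ring
  have hYl : (1 + t) / (1 - t) - l = (1 - l) * (1 + κ * t) / (1 - t) := by
    have : 1 - t ≠ 0 := by linarith
    rw [hκ]
    field_simp
    ring
  have hd1 : 0 < 1 - κ * T := by linarith
  have hd2 : 0 < 1 + κ * t := by positivity
  have hTp : 0 < 1 + T := by linarith
  have htp : 0 < 1 - t := by linarith
  refine ⟨?_, ?_, ?_⟩
  · have : 0 < Real.exp (m ^ 2 / κ) / Real.exp (2 * m / κ * q) - l := by
      rw [hX, hXl]; positivity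
    rw [← lt_div_iff₀ (Real.exp_pos _)]
    linarith
  · have : 0 < Real.exp (m ^ 2 / κ) / Real.exp (2 * m / κ * (-p)) - l := by
      rw [hY, hYl]; positivity
    rw [← lt_div_iff₀ (Real.exp_pos _)]
    linarith
  · rw [hX, hY, hXl, hYl, inv_div, inv_div]
    have e : (1 - l) * (p * ((1 + T) / ((1 - l) * (1 - κ * T))) +
        q * ((1 - t) / ((1 - l) * (1 + κ * t)))) =
        (p * (1 + T) * (1 + κ * t) + q * (1 - t) * (1 - κ * T)) /
          ((1 - κ * T) * (1 + κ * t)) := by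
      have h3 := hd1.ne'
      have h4 := hd2.ne'
      rw [eq_div_iff (by positivity)]
      generalize 1 - κ * T = D1 at *
      generalize 1 + κ * t = D2 at *
      field_simp
    rw [e, div_le_one (by positivity)]
    have : q = 1 - p := by linarith
    subst this
    -- The difference of the two sides is exactly κ + 1 times that of `h2`.
    nlinarith [mul_le_mul_of_nonneg_left h2 (by linarith : 0 ≤ κ + 1)]

end TwoPoint

end MCQMC

namespace MCQMC

/-! ### Bounded measurable functions, for which every integral below exists. -/

section BoundedMeasurable

variable {G : Type*} [MeasurableSpace G]

/-- Bounded measurable real functions. -/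
def IsBddMeas (f : G → ℝ) : Prop := Measurable f ∧ ∃ C, ∀ x, |f x| ≤ C

namespace IsBddMeas

variable {f g : G → ℝ}

theorem const (c : ℝ) : IsBddMeas (fun _ : G => c) := ⟨measurable_const, |c|, fun _ => le_rfl⟩

theorem add (hf : IsBddMeas f) (hg : IsBddMeas g) : IsBddMeas (fun x => f x + g x) := by
  obtain ⟨hf, C, hC⟩ := hf
  obtain ⟨hg, D, hD⟩ := hg
  exact ⟨hf.add hg, C + D, fun x => (abs_add_le _ _).trans (add_le_add (hC x) (hD x))⟩

theorem mul (hf : IsBddMeas f) (hg : IsBddMeas g) : IsBddMeas (fun x => f x * g x) := by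
  obtain ⟨hf, C, hC⟩ := hf
  obtain ⟨hg, D, hD⟩ := hg
  refine ⟨hf.mul hg, C * D, fun x => ?_⟩
  rw [abs_mul]
  exact mul_le_mul (hC x) (hD x) (abs_nonneg _) ((abs_nonneg _).trans (hC x))

theorem sub (hf : IsBddMeas f) (hg : IsBddMeas g) : IsBddMeas (fun x => f x - g x) := by
  have := hf.add ((const (-1)).mul hg)
  simpa [sub_eq_add_neg] using this

theorem pow (hf : IsBddMeas f) (k : ℕ) : IsBddMeas (fun x => f x ^ k) := by
  induction k with
  | zero => simpa using const 1
  | succ k ih => simpa only [pow_succ] using ih.mul hf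

theorem abs (hf : IsBddMeas f) : IsBddMeas (fun x => |f x|) := by
  obtain ⟨hf, C, hC⟩ := hf
  exact ⟨hf.abs, C, fun x => by simpa using hC x⟩

theorem comp {X : Type*} [MeasurableSpace X] (hf : IsBddMeas f) {h : X → G} (hh : Measurable h) :
    IsBddMeas (fun x => f (h x)) :=
  ⟨hf.1.comp hh, hf.2.imp fun _ hC x => hC (h x)⟩

theorem prod {ι : Type*} (t : Finset ι) {f : ι → G → ℝ} (hf : ∀ i ∈ t, IsBddMeas (f i)) :
    IsBddMeas (fun x => ∏ i ∈ t, f i x) := by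
  classical
  induction t using Finset.induction_on with
  | empty => simpa using const 1
  | insert a t ha ih =>
    simp only [Finset.prod_insert ha]
    exact (hf a (by simp)).mul (ih fun i hi => hf i (by simp [hi]))

theorem exp (hf : IsBddMeas f) : IsBddMeas (fun x => Real.exp (f x)) := by
  obtain ⟨hf, C, hC⟩ := hf
  refine ⟨hf.exp, Real.exp C, fun x => ?_⟩
  rw [abs_of_pos (Real.exp_pos _)]
  exact Real.exp_le_exp.mpr ((le_abs_self _).trans (hC x))

theorem memLp (hf : IsBddMeas f) (μ : Measure G) [IsFiniteMeasure μ] (p : ℝ≥0∞) :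
    MemLp f p μ := by
  obtain ⟨hf, C, hC⟩ := hf
  exact MemLp.of_bound hf.aestronglyMeasurable C (Filter.Eventually.of_forall hC)

theorem integrable (hf : IsBddMeas f) (μ : Measure G) [IsFiniteMeasure μ] : Integrable f μ :=
  memLp_one_iff_integrable.mp (hf.memLp μ 1)

theorem kernelMean (hf : IsBddMeas f) (K : Kernel G G) [IsMarkovKernel K] :
    IsBddMeas (kernelMean K f) := by
  obtain ⟨hf', C, hC⟩ := hf
  refine ⟨(stronglyMeasurable_kernelMean hf'.stronglyMeasurable).measurable, C, fun x => ?_⟩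
  have := norm_integral_le_of_norm_le_const (μ := K x) (f := f) (C := C) (Filter.Eventually.of_forall hC)
  simpa [MCQMC.kernelMean] using this

end IsBddMeas

theorem isBddMeas_indicator {C : Set G} (hC : MeasurableSet C) :
    IsBddMeas (C.indicator fun _ => (1 : ℝ)) := by
  refine ⟨measurable_const.indicator hC, 1, fun x => ?_⟩
  by_cases h : x ∈ C <;> simp [h]

end BoundedMeasurable

/-! ### Reversible kernels as symmetric forms. -/

section Reversible

variable {G : Type*} [MeasurableSpace G] {K : Kernel G G} [IsMarkovKernel K] {π : Measure G}
  [IsProbabilityMeasure π]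

/-- Reversibility is this identity on rectangles, and rectangles determine a finite measure. -/
theorem compProd_map_swap (hrev : K.IsReversible π) : (π ⊗ₘ K).map Prod.swap = π ⊗ₘ K := by
  have : IsFiniteMeasure ((π ⊗ₘ K).map Prod.swap) :=
    Measure.isFiniteMeasure_map _ _
  refine Measure.ext_prod fun {s t} hs ht => ?_
  rw [Measure.map_apply measurable_swap (hs.prod ht), Set.preimage_swap_prod,
    Measure.compProd_apply_prod ht hs, Measure.compProd_apply_prod hs ht, hrev ht hs]

theorem integrable_mul_compProd (hK : K.Invariant π) {f g : G → ℝ}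
    (hf : MemLp f 2 π) (hg : MemLp g 2 π) :
    Integrable (fun z : G × G => f z.1 * g z.2) (π ⊗ₘ K) := by
  have h1 : MemLp (fun z : G × G => f z.1) 2 (π ⊗ₘ K) := by
    refine MemLp.comp_measurePreserving hf ⟨measurable_fst, ?_⟩
    exact Measure.fst_compProd π K
  have h2 : MemLp (fun z : G × G => g z.2) 2 (π ⊗ₘ K) := by
    refine MemLp.comp_measurePreserving hg ⟨measurable_snd, ?_⟩
    exact (Measure.snd_compProd π K).trans hK.def
  exact h1.integrable_mul h2

theorem integral_compProd_mul (hK : K.Invariant π) {f g : G → ℝ}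
    (hf : MemLp f 2 π) (hg : MemLp g 2 π) :
    ∫ z, f z.1 * g z.2 ∂(π ⊗ₘ K) = ∫ x, f x * kernelMean K g x ∂π := by
  rw [Measure.integral_compProd (integrable_mul_compProd hK hf hg)]
  simp only [integral_const_mul, kernelMean]

/-- The Markov operator of a reversible kernel is symmetric. -/
theorem integral_mul_kernelMean_comm (hrev : K.IsReversible π) {f g : G → ℝ}
    (hf : MemLp f 2 π) (hg : MemLp g 2 π) :
    ∫ x, f x * kernelMean K g x ∂π = ∫ x, g x * kernelMean K f x ∂π := by
  rw [← integral_compProd_mul hrev.invariant hf hg, ← integral_compProd_mul hrev.invariant hg hf]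
  conv_lhs => rw [← compProd_map_swap hrev]
  rw [integral_map measurable_swap.aemeasurable]
  · simp only [Prod.fst_swap, Prod.snd_swap, mul_comm]
  · rw [compProd_map_swap hrev]
    exact (integrable_mul_compProd hrev.invariant hf hg).aestronglyMeasurable

theorem inner_markovOperator (hK : K.Invariant π) (f g : Lp ℝ 2 π) :
    inner ℝ (markovOperator K hK f) g = ∫ x, g x * kernelMean K f x ∂π := by
  rw [L2.inner_def]
  refine integral_congr_ae ?_
  filter_upwards [coeFn_markovOperator K hK f] with x hx
  rw [hx]
  simp

theorem inner_markovOperator_comm (hrev : K.IsReversible π) (f g : Lp ℝ 2 π) :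
    inner ℝ (markovOperator K hrev.invariant f) g
      = inner ℝ f (markovOperator K hrev.invariant g) := by
  rw [real_inner_comm _ f, inner_markovOperator, inner_markovOperator,
    integral_mul_kernelMean_comm hrev (Lp.memLp g) (Lp.memLp f)]

theorem isClosed_meanZero (π : Measure G) [IsProbabilityMeasure π] :
    IsClosed (meanZero π : Set (Lp ℝ 2 π)) := by
  set e : Lp ℝ 2 π := (memLp_const (1 : ℝ)).toLp (fun _ => (1 : ℝ)) with he
  have h : (meanZero π : Set (Lp ℝ 2 π)) = {f | inner ℝ e f = (0 : ℝ)} := by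
    ext f
    have : inner ℝ e f = ∫ x, f x ∂π := by
      rw [L2.inner_def]
      refine integral_congr_ae ?_
      filter_upwards [MemLp.coeFn_toLp (memLp_const (1 : ℝ) (p := 2) (μ := π))] with x hx
      rw [he, hx]
      simp
    rw [Set.mem_ofPred_eq, this]
    rfl
  rw [h]
  exact isClosed_eq (by fun_prop) continuous_const

/-- The spectral bound on the quadratic form of a reversible kernel on mean-zero functions. -/
theorem integral_mul_kernelMean_le_of_integral_eq_zero (hrev : K.IsReversible π) {f : G → ℝ}
    (hf : MemLp f 2 π) (hf0 : ∫ x, f x ∂π = 0) :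
    ∫ x, f x * kernelMean K f x ∂π ≤ spectralSup K hrev * ∫ x, f x ^ 2 ∂π := by
  have : CompleteSpace (meanZero π) := (isClosed_meanZero π).completeSpace_coe
  set F : Lp ℝ 2 π := hf.toLp f with hF
  have hFf : F =ᵐ[π] f := hf.coeFn_toLp
  have hmem : F ∈ meanZero π := by
    change ∫ x, F x ∂π = 0
    rw [integral_congr_ae hFf, hf0]
  have h := inner_apply_self_le_sSup_spectrum (markovOperatorZero K hrev.invariant)
    (fun x y => inner_markovOperator_comm hrev (x : Lp ℝ 2 π) y) ⟨F, hmem⟩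
  have h1 : inner ℝ (markovOperatorZero K hrev.invariant ⟨F, hmem⟩) (⟨F, hmem⟩ : meanZero π)
      = ∫ x, f x * kernelMean K f x ∂π := by
    refine (inner_markovOperator hrev.invariant F F).trans (integral_congr_ae ?_)
    filter_upwards [hFf, kernelMean_congr hrev.invariant hFf] with x hx hx'
    rw [hx, hx']
  have h2 : ‖(⟨F, hmem⟩ : meanZero π)‖ ^ 2 = ∫ x, f x ^ 2 ∂π := by
    rw [← real_inner_self_eq_norm_sq]
    refine (L2.inner_def (𝕜 := ℝ) F F).trans (integral_congr_ae ?_)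
    filter_upwards [hFf] with x hx
    rw [hx]
    simp
  rw [h1, h2] at h
  exact h

theorem integral_kernelMean (hK : K.Invariant π) {f : G → ℝ} (hf : IsBddMeas f) :
    ∫ x, kernelMean K f x ∂π = ∫ x, f x ∂π := by
  have h := integral_compProd_mul hK ((IsBddMeas.const 1).memLp π 2) (hf.memLp π 2)
  simp only [one_mul] at h
  rw [← h]
  have h2 : (π ⊗ₘ K).map Prod.snd = π := (Measure.snd_compProd π K).trans hK.def
  conv_rhs => rw [← h2]
  rw [integral_map measurable_snd.aemeasurable hf.1.aestronglyMeasurable]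

theorem kernelMean_sub (K : Kernel G G) [IsMarkovKernel K] {f g : G → ℝ} (hf : IsBddMeas f)
    (hg : IsBddMeas g) (x : G) :
    kernelMean K (fun x => f x - g x) x = kernelMean K f x - kernelMean K g x :=
  integral_sub (hf.integrable _) (hg.integrable _)

theorem kernelMean_add (K : Kernel G G) [IsMarkovKernel K] {f g : G → ℝ} (hf : IsBddMeas f)
    (hg : IsBddMeas g) (x : G) :
    kernelMean K (fun x => f x + g x) x = kernelMean K f x + kernelMean K g x :=
  integral_add (hf.integrable _) (hg.integrable _)

theorem kernelMean_const (K : Kernel G G) [IsMarkovKernel K] (c : ℝ) (x : G) :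
    kernelMean K (fun _ => c) x = c := by
  simp [kernelMean]

/-- A reversible kernel is dominated, as a quadratic form, by the kernel that stays put with
probability `l` and otherwise jumps to a point distributed according to `π`. -/
theorem integral_mul_kernelMean_self_le (hrev : K.IsReversible π) {l : ℝ}
    (hl : spectralSup K hrev ≤ l) {f : G → ℝ} (hf : IsBddMeas f) :
    ∫ x, f x * kernelMean K f x ∂π ≤
      (1 - l) * (∫ x, f x ∂π) ^ 2 + l * ∫ x, f x ^ 2 ∂π := by
  set c := ∫ x, f x ∂π with hc
  have hPf := hf.kernelMean K
  have hg : IsBddMeas (fun x => f x - c) := hf.sub (.const c)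
  have h0 : ∫ x, (f x - c) ∂π = 0 := by
    rw [integral_sub (hf.integrable π) (integrable_const c)]
    simp [hc]
  have h := integral_mul_kernelMean_le_of_integral_eq_zero hrev (hg.memLp π 2) h0
  have e1 : ∫ x, (f x - c) * kernelMean K (fun x => f x - c) x ∂π
      = ∫ x, f x * kernelMean K f x ∂π - c ^ 2 := by
    have : ∀ x, (f x - c) * kernelMean K (fun x => f x - c) x
        = f x * kernelMean K f x - (c * kernelMean K f x + c * (f x - c)) := by
      intro x
      rw [kernelMean_sub K hf (.const c), kernelMean_const]
      ring
    simp only [this]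
    rw [integral_sub ((hf.mul hPf).integrable π)
      ((((IsBddMeas.const c).mul hPf).add ((IsBddMeas.const c).mul hg)).integrable π),
      integral_add (((IsBddMeas.const c).mul hPf).integrable π)
        (((IsBddMeas.const c).mul hg).integrable π),
      integral_const_mul, integral_const_mul, h0, integral_kernelMean hrev.invariant hf, ← hc]
    ring
  have e2 : ∫ x, (f x - c) ^ 2 ∂π = ∫ x, f x ^ 2 ∂π - c ^ 2 := by
    have : ∀ x, (f x - c) ^ 2 = f x ^ 2 - (c * f x + c * (f x - c)) := by
      intro x
      ring
    simp only [this]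
    rw [integral_sub ((hf.pow 2).integrable π)
      ((((IsBddMeas.const c).mul hf).add ((IsBddMeas.const c).mul hg)).integrable π),
      integral_add (((IsBddMeas.const c).mul hf).integrable π)
        (((IsBddMeas.const c).mul hg).integrable π),
      integral_const_mul, integral_const_mul, h0, ← hc]
    ring
  have h3 : 0 ≤ ∫ x, (f x - c) ^ 2 ∂π := integral_nonneg fun x => sq_nonneg _
  have h4 := h.trans (mul_le_mul_of_nonneg_right hl h3)
  rw [e1, e2] at h4
  linarith

/-- Positivity of the kernel bounds the form from below without information on the bottom of the
spectrum. Since |f| need not have mean zero, the upper bound has to hold on all functions. -/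
theorem neg_integral_mul_kernelMean_self_le (π : Measure G) [IsProbabilityMeasure π]
    (K : Kernel G G) [IsMarkovKernel K] {f : G → ℝ} (hf : IsBddMeas f) :
    -∫ x, f x * kernelMean K f x ∂π ≤ ∫ x, |f x| * kernelMean K (fun y => |f y|) x ∂π := by
  rw [← integral_neg]
  refine integral_mono ((hf.mul (hf.kernelMean K)).integrable π).neg
    ((hf.abs.mul (hf.abs.kernelMean K)).integrable π) fun x => ?_
  have : |kernelMean K f x| ≤ kernelMean K (fun y => |f y|) x := abs_integral_le_integral_abs
  calc -(f x * kernelMean K f x) ≤ |f x * kernelMean K f x| := neg_le_abs _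
    _ = |f x| * |kernelMean K f x| := abs_mul _ _
    _ ≤ _ := mul_le_mul_of_nonneg_left this (abs_nonneg _)

end Reversible

end MCQMC

namespace MCQMC

/-! ### Exponential moments of the stationary chain. -/

section Tilted

variable {G : Type*} [MeasurableSpace G] {K : Kernel G G} [IsMarkovKernel K] {π : Measure G}
  [IsProbabilityMeasure π]

/-- `tiltedIterate K w n x` is the expectation of `w(X₁) ⋯ w(Xₙ)` for the chain with kernel `K`
started at `X₁ = x`. -/
noncomputable def tiltedIterate (K : Kernel G G) (w : G → ℝ) : ℕ → G → ℝ
  | 0 => fun _ => 1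
  | k + 1 => fun x => w x * kernelMean K (tiltedIterate K w k) x

theorem isBddMeas_tiltedIterate {w : G → ℝ} (hw : IsBddMeas w) (k : ℕ) :
    IsBddMeas (tiltedIterate K w k) := by
  induction k with
  | zero => exact .const 1
  | succ k ih => exact hw.mul (ih.kernelMean K)

theorem tiltedIterate_nonneg {K : Kernel G G} {w : G → ℝ} (hw : ∀ x, 0 ≤ w x) (k : ℕ) (x : G) :
    0 ≤ tiltedIterate K w k x := by
  induction k generalizing x with
  | zero => exact zero_le_one
  | succ k ih => exact mul_nonneg (hw x) (integral_nonneg ih)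

theorem kernelMean_sq_le {f : G → ℝ} (hf : IsBddMeas f) (x : G) :
    kernelMean K f x ^ 2 ≤ kernelMean K (fun y => f y ^ 2) x := by
  set c := kernelMean K f x with hc
  have h : 0 ≤ ∫ y, (f y - c) ^ 2 ∂(K x) := integral_nonneg fun y => sq_nonneg _
  have e : ∀ y, (f y - c) ^ 2 = f y ^ 2 - (2 * c * f y - c ^ 2) := fun y => by ring
  simp only [e] at h
  rw [integral_sub ((hf.pow 2).integrable _)
    ((((IsBddMeas.const (2 * c)).mul hf).sub (.const (c ^ 2))).integrable _),
    integral_sub (((IsBddMeas.const (2 * c)).mul hf).integrable _) (integrable_const _),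
    integral_const_mul] at h
  have h2 : ∫ y, f y ∂(K x) = c := rfl
  rw [h2] at h
  simp only [integral_const, probReal_univ, smul_eq_mul, one_mul] at h
  change c ^ 2 ≤ ∫ y, f y ^ 2 ∂(K x)
  linarith

/-- Jensen at every step. It moves the square from Cauchy-Schwarz into the weight. -/
theorem tiltedIterate_sq_le {w : G → ℝ} (hw : IsBddMeas w) (k : ℕ) (x : G) :
    tiltedIterate K w k x ^ 2 ≤ tiltedIterate K (fun y => w y ^ 2) k x := by
  induction k generalizing x with
  | zero => simp [tiltedIterate]
  | succ k ih =>
    simp only [tiltedIterate]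
    rw [mul_pow]
    refine mul_le_mul_of_nonneg_left ?_ (sq_nonneg _)
    refine (kernelMean_sq_le (isBddMeas_tiltedIterate hw k) x).trans ?_
    exact integral_mono (((isBddMeas_tiltedIterate hw k).pow 2).integrable _)
      ((isBddMeas_tiltedIterate (hw.pow 2) k).integrable _) ih

/-- With c = 1/(Rv - l), expand ∫ (H - sc)²/c ≥ 0 at s = (1-l)∫H; the integral condition on c
absorbs the s² term. -/
theorem rankOne_form_le {v c : G → ℝ} (hv : IsBddMeas v) (hc : IsBddMeas c) {l R : ℝ}
    (hl1 : l ≤ 1) (hc0 : ∀ x, 0 < c x) (hcv : ∀ x, c x * (R * v x - l) = 1)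
    (hint : (1 - l) * ∫ x, c x ∂π ≤ 1) {H : G → ℝ} (hH : IsBddMeas H) :
    (1 - l) * (∫ x, H x ∂π) ^ 2 + l * ∫ x, H x ^ 2 ∂π ≤ R * ∫ x, H x ^ 2 * v x ∂π := by
  set h := ∫ x, H x ∂π with hh
  set s := (1 - l) * h with hs
  have h0 : 0 ≤ ∫ x, (R * v x - l) * (H x - s * c x) ^ 2 ∂π := by
    refine integral_nonneg fun x => mul_nonneg ?_ (sq_nonneg _)
    refine (pos_of_mul_pos_right ?_ (hc0 x).le).le
    rw [hcv]
    exact one_pos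
  have e : ∀ x, (R * v x - l) * (H x - s * c x) ^ 2
      = (R * (H x ^ 2 * v x) - l * H x ^ 2) - (2 * s * H x - s ^ 2 * c x) := by
    intro x
    linear_combination (s ^ 2 * c x - 2 * s * H x) * hcv x
  simp only [e] at h0
  have i1 := (IsBddMeas.const R).mul ((hH.pow 2).mul hv)
  have i2 := (IsBddMeas.const l).mul (hH.pow 2)
  have i3 := (IsBddMeas.const (2 * s)).mul hH
  have i4 := (IsBddMeas.const (s ^ 2)).mul hc
  rw [integral_sub ((i1.sub i2).integrable π) ((i3.sub i4).integrable π),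
    integral_sub (i1.integrable π) (i2.integrable π),
    integral_sub (i3.integrable π) (i4.integrable π), integral_const_mul, integral_const_mul,
    integral_const_mul, integral_const_mul, ← hh] at h0
  have h1 : s ^ 2 * ∫ x, c x ∂π ≤ (1 - l) * h ^ 2 := by
    have := mul_le_mul_of_nonneg_left hint (mul_nonneg (sub_nonneg.mpr hl1) (sq_nonneg h))
    rw [hs]
    linarith
  have h2 : 2 * s * h = 2 * ((1 - l) * h ^ 2) := by rw [hs]; ring
  linarith

/-- Test the form bound on H = w, where w²v = w, and use (∫w)² ≤ ∫w². -/
theorem integral_weight_le {w v c : G → ℝ} (hw : IsBddMeas w) (hv : IsBddMeas v)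
    (hc : IsBddMeas c) {l R : ℝ} (hl0 : 0 ≤ l) (hl1 : l ≤ 1) (hR : 0 ≤ R) (hw0 : ∀ x, 0 ≤ w x)
    (hwv : ∀ x, w x * v x = 1) (hc0 : ∀ x, 0 < c x) (hcv : ∀ x, c x * (R * v x - l) = 1)
    (hint : (1 - l) * ∫ x, c x ∂π ≤ 1) : ∫ x, w x ∂π ≤ R := by
  have h := rankOne_form_le hv hc hl1 hc0 hcv hint hw
  have e : ∀ x, w x ^ 2 * v x = w x := fun x => by linear_combination w x * hwv x
  simp only [e] at h
  set W := ∫ x, w x ∂π with hW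
  have hW0 : 0 ≤ W := integral_nonneg hw0
  have h2 : W ^ 2 ≤ ∫ x, w x ^ 2 ∂π := by
    have h0 : 0 ≤ ∫ x, (w x - W) ^ 2 ∂π := integral_nonneg fun x => sq_nonneg _
    have e : ∀ x, (w x - W) ^ 2 = w x ^ 2 - (2 * W * w x - W ^ 2) := fun x => by ring
    simp only [e] at h0
    have i := (IsBddMeas.const (2 * W)).mul hw
    rw [integral_sub ((hw.pow 2).integrable π) ((i.sub (.const _)).integrable π),
      integral_sub (i.integrable π) (integrable_const _), integral_const_mul, ← hW] at h0
    simp only [integral_const, probReal_univ, smul_eq_mul, one_mul] at h0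
    linarith
  have h3 : W * W ≤ R * W := by nlinarith [mul_le_mul_of_nonneg_left h2 hl0]
  rcases hW0.eq_or_lt with h4 | h4
  · rw [← h4]; exact hR
  · exact le_of_mul_le_mul_right h3 h4

/-- The weighted operator norm bound for a reversible kernel. -/
theorem integral_mul_kernelMean_sq_le (hrev : K.IsReversible π) {w v c : G → ℝ}
    (hw : IsBddMeas w) (hv : IsBddMeas v)
    (hc : IsBddMeas c) {l R : ℝ} (hl : spectralSup K hrev ≤ l) (hl1 : l ≤ 1) (hR : 0 < R)
    (hwv : ∀ x, w x * v x = 1) (hc0 : ∀ x, 0 < c x) (hcv : ∀ x, c x * (R * v x - l) = 1)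
    (hint : (1 - l) * ∫ x, c x ∂π ≤ 1) {F : G → ℝ} (hF : IsBddMeas F) :
    ∫ x, w x * kernelMean K F x ^ 2 ∂π ≤ R ^ 2 * ∫ x, F x ^ 2 * v x ∂π := by
  have hquad : ∀ {H : G → ℝ}, IsBddMeas H →
      ∫ x, H x * kernelMean K H x ∂π ≤ R * ∫ x, H x ^ 2 * v x ∂π := fun hH =>
    (integral_mul_kernelMean_self_le hrev hl hH).trans (rankOne_form_le hv hc hl1 hc0 hcv hint hH)
  have hPF := hF.kernelMean K
  -- Polarization against the near-extremal E = R⁻¹wPF: 4∫E·PF is the form at E + F minus that at E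
  -- - F. The parallelogram law for the weight v then closes the estimate.
  set E : G → ℝ := fun x => R⁻¹ * (w x * kernelMean K F x) with hE
  have hEb : IsBddMeas E := (IsBddMeas.const R⁻¹).mul (hw.mul hPF)
  have hPE := hEb.kernelMean K
  have h1 := hquad (hEb.add hF)
  have h2 := (neg_integral_mul_kernelMean_self_le π K (hEb.sub hF)).trans
    (hquad (hEb.sub hF).abs)
  simp only [sq_abs] at h2
  have hcomm := integral_mul_kernelMean_comm hrev (hEb.memLp π 2) (hF.memLp π 2)
  have e1 : ∫ x, (E x + F x) * kernelMean K (fun x => E x + F x) x ∂π =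
      (∫ x, E x * kernelMean K E x ∂π + ∫ x, F x * kernelMean K F x ∂π) +
        2 * ∫ x, E x * kernelMean K F x ∂π := by
    have : ∀ x, (E x + F x) * kernelMean K (fun x => E x + F x) x =
        (E x * kernelMean K E x + F x * kernelMean K F x) +
          (E x * kernelMean K F x + F x * kernelMean K E x) := by
      intro x; rw [kernelMean_add K hEb hF]; ring
    simp only [this]
    rw [integral_add (((hEb.mul hPE).add (hF.mul hPF)).integrable π)
      (((hEb.mul hPF).add (hF.mul hPE)).integrable π),
      integral_add ((hEb.mul hPE).integrable π) ((hF.mul hPF).integrable π),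
      integral_add ((hEb.mul hPF).integrable π) ((hF.mul hPE).integrable π), ← hcomm]
    ring
  have e2 : ∫ x, (E x - F x) * kernelMean K (fun x => E x - F x) x ∂π =
      (∫ x, E x * kernelMean K E x ∂π + ∫ x, F x * kernelMean K F x ∂π) -
        2 * ∫ x, E x * kernelMean K F x ∂π := by
    have : ∀ x, (E x - F x) * kernelMean K (fun x => E x - F x) x =
        (E x * kernelMean K E x + F x * kernelMean K F x) -
          (E x * kernelMean K F x + F x * kernelMean K E x) := by
      intro x; rw [kernelMean_sub K hEb hF]; ring
    simp only [this]
    rw [integral_sub (((hEb.mul hPE).add (hF.mul hPF)).integrable π)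
      (((hEb.mul hPF).add (hF.mul hPE)).integrable π),
      integral_add ((hEb.mul hPE).integrable π) ((hF.mul hPF).integrable π),
      integral_add ((hEb.mul hPF).integrable π) ((hF.mul hPE).integrable π), ← hcomm]
    ring
  have e3 : ∫ x, (E x + F x) ^ 2 * v x ∂π + ∫ x, (E x - F x) ^ 2 * v x ∂π =
      2 * ∫ x, E x ^ 2 * v x ∂π + 2 * ∫ x, F x ^ 2 * v x ∂π := by
    rw [← integral_add ((((hEb.add hF).pow 2).mul hv).integrable π)
      ((((hEb.sub hF).pow 2).mul hv).integrable π), ← integral_const_mul, ← integral_const_mul,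
      ← integral_add (((IsBddMeas.const 2).mul ((hEb.pow 2).mul hv)).integrable π)
      (((IsBddMeas.const 2).mul ((hF.pow 2).mul hv)).integrable π)]
    refine integral_congr_ae (Filter.Eventually.of_forall fun x => ?_)
    ring
  have e4 : ∫ x, E x * kernelMean K F x ∂π = R⁻¹ * ∫ x, w x * kernelMean K F x ^ 2 ∂π := by
    rw [← integral_const_mul]
    refine integral_congr_ae (Filter.Eventually.of_forall fun x => ?_)
    simp only [hE]
    ring
  have e5 : ∫ x, E x ^ 2 * v x ∂π = R⁻¹ ^ 2 * ∫ x, w x * kernelMean K F x ^ 2 ∂π := by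
    rw [← integral_const_mul]
    refine integral_congr_ae (Filter.Eventually.of_forall fun x => ?_)
    simp only [hE]
    linear_combination (R⁻¹ ^ 2 * w x * kernelMean K F x ^ 2) * hwv x
  rw [e1] at h1
  rw [e2] at h2
  set x := ∫ x, w x * kernelMean K F x ^ 2 ∂π
  set y := ∫ x, F x ^ 2 * v x ∂π
  have h3 : 4 * (R⁻¹ * x) ≤ R * (2 * (R⁻¹ ^ 2 * x) + 2 * y) := by
    rw [← e5, ← e3, ← e4]
    linarith
  have h4 : R * (4 * (R⁻¹ * x)) ≤ R * (R * (2 * (R⁻¹ ^ 2 * x) + 2 * y)) :=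
    mul_le_mul_of_nonneg_left h3 hR.le
  have e6 : R * (4 * (R⁻¹ * x)) = 4 * x := by field_simp
  have e7 : R * (R * (2 * (R⁻¹ ^ 2 * x) + 2 * y)) = 2 * x + 2 * (R ^ 2 * y) := by
    field_simp
  rw [e6, e7] at h4
  linarith

/-- Let Fₖ be the iterates. In the norm with weight v, ‖F₁‖² = ∫w ≤ R and each step costs R², so
‖Fₙ₊₁‖² ≤ R²ⁿ⁺¹. Cauchy-Schwarz against w supplies the missing factor R. -/
theorem integral_tiltedIterate_le (hrev : K.IsReversible π) {w v c : G → ℝ}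
    (hw : IsBddMeas w) (hv : IsBddMeas v) (hc : IsBddMeas c) {l R : ℝ}
    (hl : spectralSup K hrev ≤ l) (hl0 : 0 ≤ l) (hl1 : l ≤ 1) (hR : 0 < R) (hw0 : ∀ x, 0 ≤ w x)
    (hwv : ∀ x, w x * v x = 1) (hc0 : ∀ x, 0 < c x) (hcv : ∀ x, c x * (R * v x - l) = 1)
    (hint : (1 - l) * ∫ x, c x ∂π ≤ 1) (n : ℕ) :
    ∫ x, tiltedIterate K w n x ∂π ≤ R ^ n := by
  have hW : ∫ x, w x ∂π ≤ R := integral_weight_le hw hv hc hl0 hl1 hR.le hw0 hwv hc0 hcv hint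
  have hN : ∀ k, ∫ x, tiltedIterate K w (k + 1) x ^ 2 * v x ∂π ≤ (R ^ k) ^ 2 * R := by
    intro k
    have e : ∀ x, tiltedIterate K w (k + 1) x ^ 2 * v x =
        w x * kernelMean K (tiltedIterate K w k) x ^ 2 := by
      intro x
      simp only [tiltedIterate]
      linear_combination (w x * kernelMean K (tiltedIterate K w k) x ^ 2) * hwv x
    simp only [e]
    induction k with
    | zero =>
      simp only [tiltedIterate, kernelMean_const]
      simpa using hW
    | succ k ih =>
      refine (integral_mul_kernelMean_sq_le hrev hw hv hc hl hl1 hR hwv hc0 hcv hint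
        (isBddMeas_tiltedIterate hw (k + 1))).trans ?_
      have e' : ∀ x, tiltedIterate K w (k + 1) x ^ 2 * v x =
          w x * kernelMean K (tiltedIterate K w k) x ^ 2 := by
        intro x
        simp only [tiltedIterate]
        linear_combination (w x * kernelMean K (tiltedIterate K w k) x ^ 2) * hwv x
      have := mul_le_mul_of_nonneg_left (ih e') (sq_nonneg R)
      simp only [e']
      refine this.trans (le_of_eq ?_)
      ring
  cases n with
  | zero => simp [tiltedIterate]
  | succ n =>
    set F := tiltedIterate K w (n + 1) with hFdef
    have hF : IsBddMeas F := isBddMeas_tiltedIterate hw (n + 1)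
    have hRn : 0 < R ^ n := pow_pos hR n
    have h0 : 0 ≤ ∫ x, w x * (F x * v x - R ^ n) ^ 2 ∂π :=
      integral_nonneg fun x => mul_nonneg (hw0 x) (sq_nonneg _)
    have e : ∀ x, w x * (F x * v x - R ^ n) ^ 2 =
        F x ^ 2 * v x - (2 * R ^ n * F x - (R ^ n) ^ 2 * w x) := by
      intro x
      linear_combination (F x ^ 2 * v x - 2 * R ^ n * F x) * hwv x
    simp only [e] at h0
    have i1 := (IsBddMeas.const (2 * R ^ n)).mul hF
    have i2 := (IsBddMeas.const ((R ^ n) ^ 2)).mul hw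
    rw [integral_sub (((hF.pow 2).mul hv).integrable π) ((i1.sub i2).integrable π),
      integral_sub (i1.integrable π) (i2.integrable π), integral_const_mul,
      integral_const_mul] at h0
    have h1 := hN n
    have h2 := mul_le_mul_of_nonneg_left hW (sq_nonneg (R ^ n))
    have h3 : R ^ n * ∫ x, F x ∂π ≤ R ^ n * R ^ (n + 1) := by
      rw [pow_succ]
      linarith
    exact le_of_mul_le_mul_left h3 hRn

/-- The centred indicator of a set. -/
noncomputable def centredIndicator (π : Measure G) (C : Set G) (x : G) : ℝ :=
  C.indicator (fun _ => (1 : ℝ)) x - π.real C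

theorem isBddMeas_centredIndicator (π : Measure G) {C : Set G} (hC : MeasurableSet C) :
    IsBddMeas (centredIndicator π C) :=
  (isBddMeas_indicator hC).sub (.const _)

/-- Exponential moments of the occupation time of a set for a stationary reversible chain. -/
theorem integral_tiltedIterate_indicator_le (hrev : K.IsReversible π) {C : Set G}
    (hC : MeasurableSet C) {l κ m : ℝ} (hl : spectralSup K hrev ≤ l) (hl0 : 0 ≤ l) (hl1 : l < 1)
    (hκ : κ = (1 + l) / (1 - l)) (hm : 0 ≤ m) (hm1 : m ≤ 1) (n : ℕ) :
    ∫ x, tiltedIterate K (fun y => Real.exp (2 * m / κ * centredIndicator π C y)) n x ∂π ≤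
      Real.exp (m ^ 2 / κ) ^ n := by
  set p := π.real C with hp
  have hp1 : p ≤ 1 := measureReal_le_one
  obtain ⟨h1, h2, h3⟩ := two_point_inequality (p := p) (q := 1 - p) measureReal_nonneg
    (by linarith) (by ring) hm hm1 hl0 hl1 hκ
  set R := Real.exp (m ^ 2 / κ) with hR
  set x1 := Real.exp (2 * m / κ * (1 - p)) with hx1
  set x2 := Real.exp (2 * m / κ * (-p)) with hx2
  have hx1p : 0 < x1 := Real.exp_pos _
  have hx2p : 0 < x2 := Real.exp_pos _
  have hb1 : 0 < R / x1 - l := by rw [sub_pos, lt_div_iff₀ hx1p]; exact h1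
  have hb2 : 0 < R / x2 - l := by rw [sub_pos, lt_div_iff₀ hx2p]; exact h2
  have hg := isBddMeas_centredIndicator π hC
  have hind := isBddMeas_indicator hC
  -- This is 1/(Rv - l), written out on C and off C.
  set c : G → ℝ := fun x => (R / x1 - l)⁻¹ * C.indicator (fun _ => (1 : ℝ)) x +
    (R / x2 - l)⁻¹ * (1 - C.indicator (fun _ => (1 : ℝ)) x) with hcdef
  have hcC : ∀ x ∈ C, c x = (R / x1 - l)⁻¹ := fun x hx => by simp [hcdef, hx]
  have hcC' : ∀ x ∉ C, c x = (R / x2 - l)⁻¹ := fun x hx => by simp [hcdef, hx]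
  have hc : IsBddMeas c := ((IsBddMeas.const _).mul hind).add
    ((IsBddMeas.const _).mul ((IsBddMeas.const 1).sub hind))
  have hgC : ∀ x ∈ C, centredIndicator π C x = 1 - p := fun x hx => by
    simp [centredIndicator, hx, hp]
  have hgC' : ∀ x ∉ C, centredIndicator π C x = -p := fun x hx => by
    simp [centredIndicator, hx, hp]
  refine integral_tiltedIterate_le hrev (v := fun y => Real.exp (-(2 * m / κ *
    centredIndicator π C y))) (c := c) ((IsBddMeas.const _).mul hg).exp ?_ hc hl hl0 hl1.le
    (Real.exp_pos _) (fun x => (Real.exp_pos _).le) ?_ ?_ ?_ ?_ n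
  · have := ((IsBddMeas.const (-(2 * m / κ))).mul hg).exp
    simpa only [neg_mul] using this
  · intro x
    rw [← Real.exp_add, add_neg_cancel, Real.exp_zero]
  · intro x
    by_cases hx : x ∈ C
    · rw [hcC x hx]; positivity
    · rw [hcC' x hx]; positivity
  · intro x
    rw [Real.exp_neg]
    by_cases hx : x ∈ C
    · rw [hcC x hx, hgC x hx, ← div_eq_mul_inv]
      exact inv_mul_cancel₀ hb1.ne'
    · rw [hcC' x hx, hgC' x hx, ← div_eq_mul_inv]
      exact inv_mul_cancel₀ hb2.ne'
  · refine le_trans (le_of_eq ?_) h3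
    congr 1
    have hi : ∫ x, C.indicator (fun _ => (1 : ℝ)) x ∂π = p := by
      rw [integral_indicator hC]; simp [hp]
    rw [hcdef, integral_add (((IsBddMeas.const _).mul hind).integrable π)
      (((IsBddMeas.const _).mul ((IsBddMeas.const 1).sub hind)).integrable π),
      integral_const_mul, integral_const_mul, integral_sub (integrable_const _)
      (hind.integrable π), hi]
    simp only [integral_const, probReal_univ, smul_eq_mul, one_mul]
    ring

end Tilted

end MCQMC

namespace MCQMC

/-! ### The driven chain and its Hoeffding bound. -/

section DrivenChain

variable {G : Type*} [MeasurableSpace G] {K : Kernel G G} [IsMarkovKernel K] {s : ℕ}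

theorem measurable_drivenPoint {n : ℕ} {φ : G → Cube s → G} (hφ : Measurable (Function.uncurry φ))
    {ψ : Cube s → G} (hψ : Measurable ψ) (i : ℕ) (hi : i < n) :
    Measurable fun u : Fin n → Cube s => drivenPoint φ ψ u i hi := by
  induction i with
  | zero => exact hψ.comp (measurable_pi_apply _)
  | succ i ih => exact hφ.comp ((ih (Nat.lt_of_succ_lt hi)).prodMk (measurable_pi_apply _))

/-- The first step is absorbed into the generator: φ(ψ(u₀)) generates K(ψ(u₀)). This permits
induction on n over all initial laws. -/
theorem drivenPoint_succ {G : Type*} {n : ℕ} (φ : G → Cube s → G) (ψ : Cube s → G)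
    (u : Fin (n + 1) → Cube s) (i : ℕ) (hi : i + 1 < n + 1) :
    drivenPoint φ ψ u (i + 1) hi =
      drivenPoint φ (φ (ψ (u 0))) (fun j => u j.succ) i (Nat.lt_of_succ_lt_succ hi) := by
  induction i with
  | zero => rfl
  | succ i ih =>
    rw [drivenPoint, ih (Nat.lt_of_succ_lt hi)]
    rfl

theorem IsGeneratorFunction.map_eq {ν : Measure G} {ψ : Cube s → G}
    (hψ : IsGeneratorFunction ν ψ) : (volume : Measure (Cube s)).map ψ = ν := by
  ext A hA
  rw [Measure.map_apply hψ.1 hA, hψ.2 A hA]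
  rfl

theorem IsUpdateFunction.isGeneratorFunction {K : Kernel G G} {φ : G → Cube s → G}
    (hφ : IsUpdateFunction K φ)
    (x : G) : IsGeneratorFunction (K x) (φ x) :=
  ⟨hφ.1.comp measurable_prodMk_left, fun A hA => hφ.2 x A hA⟩

theorem isBddMeas_prod_drivenPoints {n : ℕ} {φ : G → Cube s → G}
    (hφ : Measurable (Function.uncurry φ)) {ψ : Cube s → G} (hψ : Measurable ψ) {w : G → ℝ}
    (hw : IsBddMeas w) :
    IsBddMeas fun u : Fin n → Cube s => ∏ i, w (drivenPoints φ ψ u i) :=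
  .prod _ fun i _ => hw.comp (measurable_drivenPoint hφ hψ i i.isLt)

/-- Expectations of products along the driven chain. -/
theorem integral_prod_drivenPoints {φ : G → Cube s → G} (hφ : IsUpdateFunction K φ) {w : G → ℝ}
    (hw : IsBddMeas w) (n : ℕ) (ν : Measure G) [IsProbabilityMeasure ν] (ψ : Cube s → G)
    (hψ : IsGeneratorFunction ν ψ) :
    ∫ u : Fin n → Cube s, ∏ i, w (drivenPoints φ ψ u i) = ∫ x, tiltedIterate K w n x ∂ν := by
  induction n generalizing ν ψ with
  | zero => simp [tiltedIterate]
  | succ n ih =>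
    have hmp := volume_preserving_piFinSuccAbove (fun _ : Fin (n + 1) => Cube s) 0
    have hsymm := hmp.symm
    have hb := isBddMeas_prod_drivenPoints (n := n + 1) hφ.1 hψ.1 hw
    rw [← hsymm.integral_comp (MeasurableEquiv.measurableEmbedding _), Measure.volume_eq_prod,
      integral_prod _ ((hb.comp (MeasurableEquiv.measurable _)).integrable _)]
    rw [← hψ.map_eq, integral_map hψ.1.aemeasurable
      (isBddMeas_tiltedIterate hw (n + 1)).1.aestronglyMeasurable]
    refine integral_congr_ae (Filter.Eventually.of_forall fun u₀ => ?_)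
    simp only [tiltedIterate, kernelMean]
    rw [← ih (K (ψ u₀)) (φ (ψ u₀)) (hφ.isGeneratorFunction (ψ u₀)), ← integral_const_mul]
    refine integral_congr_ae (Filter.Eventually.of_forall fun u => ?_)
    simp only
    rw [Fin.prod_univ_succ]
    congr 1
    refine Finset.prod_congr rfl fun i _ => ?_
    congr 1
    exact drivenPoint_succ φ ψ _ i _

/-- Cauchy-Schwarz for the change of measure from `π` to `ν`. -/
theorem integral_le_lpNorm_density_mul {π ν : Measure G} [IsProbabilityMeasure π]
    [IsProbabilityMeasure ν] (hac : ν ≪ π) (hdens : MemLp (density ν π) 2 π) {F : G → ℝ}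
    (hF : IsBddMeas F) (hF0 : ∀ x, 0 ≤ F x) :
    ∫ x, F x ∂ν ≤ lpNorm (density ν π) 2 π * √(∫ x, F x ^ 2 ∂π) := by
  have h0 : ∀ x, 0 ≤ density ν π x := fun x => ENNReal.toReal_nonneg
  have h1 : ∫ x, F x ∂ν = ∫ x, density ν π x * F x ∂π := (integral_toReal_rnDeriv_mul hac).symm
  have h2 := integral_mul_le_Lp_mul_Lq_of_nonneg Real.HolderConjugate.two_two
    (Filter.Eventually.of_forall h0) (Filter.Eventually.of_forall hF0)
    (by simpa using hdens) (hF.memLp π _)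
  rw [h1]
  refine h2.trans (le_of_eq ?_)
  rw [lpNorm_eq_integral_norm_rpow_toReal (by norm_num) (by norm_num) hdens.1, Real.sqrt_eq_rpow]
  simp only [ENNReal.toReal_ofNat, Real.norm_eq_abs, abs_of_nonneg (h0 _), Real.rpow_ofNat,
    one_div]

theorem one_le_lpNorm_density {π ν : Measure G} [IsProbabilityMeasure π]
    [IsProbabilityMeasure ν] (hac : ν ≪ π) (hdens : MemLp (density ν π) 2 π) :
    1 ≤ lpNorm (density ν π) 2 π := by
  simpa using integral_le_lpNorm_density_mul hac hdens (.const 1) (fun _ => zero_le_one)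

variable {π ν : Measure G} [IsProbabilityMeasure π] [IsProbabilityMeasure ν]

/-- A Hoeffding bound for the occupation time of a set along the driven chain. -/
theorem measureReal_sum_centredIndicator_ge_le (hrev : K.IsReversible π) (hac : ν ≪ π)
    (hdens : MemLp (density ν π) 2 π) {φ : G → Cube s → G} (hφ : IsUpdateFunction K φ)
    {ψ : Cube s → G} (hψ : IsGeneratorFunction ν ψ) {C : Set G} (hC : MeasurableSet C)
    {l κ c : ℝ} (hl : spectralSup K hrev ≤ l) (hl0 : 0 ≤ l) (hl1 : l < 1)
    (hκ : κ = (1 + l) / (1 - l)) (hc0 : 0 ≤ c) (hc1 : c ≤ 1) (n : ℕ) :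
    volume.real {u : Fin n → Cube s |
        n * c ≤ ∑ i, centredIndicator π C (drivenPoints φ ψ u i)} ≤
      lpNorm (density ν π) 2 π * Real.exp (-(n * c ^ 2 / (2 * κ))) := by
  have hκ0 : 0 < κ := by rw [hκ]; exact div_pos (by linarith) (by linarith)
  have hg := isBddMeas_centredIndicator π hC
  -- The minimizer of κt²/2 - tc. After squaring, the tilt is 2c/κ, so m = c and c ≤ 1 is needed.
  set t := c / κ with ht
  have ht0 : 0 ≤ t := by positivity
  set w : G → ℝ := fun x => Real.exp (t * centredIndicator π C x) with hwdef
  have hw : IsBddMeas w := ((IsBddMeas.const t).mul hg).exp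
  set X : (Fin n → Cube s) → ℝ := fun u => ∑ i, centredIndicator π C (drivenPoints φ ψ u i) with hX
  have hexp : ∀ u, Real.exp (t * X u) = ∏ i, w (drivenPoints φ ψ u i) := fun u => by
    simp only [hX, hwdef, Finset.mul_sum, Real.exp_sum]
  have hmgf : mgf X volume t ≤ lpNorm (density ν π) 2 π * Real.exp (n * c ^ 2 / (2 * κ)) := by
    have e : mgf X volume t = ∫ x, tiltedIterate K w n x ∂ν := by
      simp only [mgf, hexp]
      exact integral_prod_drivenPoints hφ hw n ν ψ hψ
    rw [e]
    have hT := isBddMeas_tiltedIterate (K := K) hw n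
    refine (integral_le_lpNorm_density_mul hac hdens hT
      (tiltedIterate_nonneg (fun x => (Real.exp_pos _).le) n)).trans ?_
    refine mul_le_mul_of_nonneg_left ?_ lpNorm_nonneg
    have h1 : ∫ x, tiltedIterate K w n x ^ 2 ∂π ≤ Real.exp (c ^ 2 / κ) ^ n := by
      have hw2 : (fun y => w y ^ 2) =
          fun y => Real.exp (2 * c / κ * centredIndicator π C y) := by
        funext y
        simp only [hwdef]
        rw [← Real.exp_nat_mul, ht]
        congr 1
        push_cast
        ring
      refine le_trans ?_ (integral_tiltedIterate_indicator_le hrev hC hl hl0 hl1 hκ hc0 hc1 n)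
      rw [← hw2]
      exact integral_mono ((hT.pow 2).integrable π)
        ((isBddMeas_tiltedIterate (hw.pow 2) n).integrable π) (tiltedIterate_sq_le hw n)
    refine Real.sqrt_le_iff.mpr ⟨(Real.exp_pos _).le, h1.trans (le_of_eq ?_)⟩
    rw [← Real.exp_nat_mul, ← Real.exp_nat_mul]
    congr 1
    push_cast
    field_simp
  have h := measure_ge_le_exp_mul_mgf (μ := volume) (X := X) (n * c) ht0
    (by
      simp only [hexp]
      exact (isBddMeas_prod_drivenPoints hφ.1 hψ.1 hw).integrable _)
  refine h.trans ((mul_le_mul_of_nonneg_left hmgf (Real.exp_pos _).le).trans (le_of_eq ?_))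
  rw [mul_left_comm, ← Real.exp_add]
  congr 2
  rw [ht]
  field_simp
  ring

/-! ### Union bound and passage from the cover to the discrepancy. -/

theorem centredIndicator_compl {C : Set G} (hC : MeasurableSet C) (x : G) :
    centredIndicator π Cᶜ x = -centredIndicator π C x := by
  rw [centredIndicator, centredIndicator, probReal_compl_eq_one_sub hC]
  by_cases hx : x ∈ C <;> simp [hx]

theorem average_sub_measureReal {π : Measure G} {n : ℕ} (hn : 1 ≤ n) (A : Set G) (x : Fin n → G) :
    (1 / (n : ℝ)) * ∑ i, A.indicator (fun _ => (1 : ℝ)) (x i) - π.real A =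
      (1 / (n : ℝ)) * ∑ i, centredIndicator π A (x i) := by
  have : (n : ℝ) ≠ 0 := by positivity
  simp only [centredIndicator, Finset.sum_sub_distrib, Finset.sum_const, Finset.card_univ,
    Fintype.card_fin, nsmul_eq_mul]
  field_simp

/-- Simultaneous control of finitely many sets by the union bound. -/
theorem exists_forall_abs_average_sub_le (hrev : K.IsReversible π) (hac : ν ≪ π)
    (hdens : MemLp (density ν π) 2 π) {φ : G → Cube s → G} (hφ : IsUpdateFunction K φ)
    {ψ : Cube s → G} (hψ : IsGeneratorFunction ν ψ) (Γ : Finset (Set G))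
    (hΓ : ∀ C ∈ Γ, MeasurableSet C) {l κ c : ℝ} (hl : spectralSup K hrev ≤ l) (hl0 : 0 ≤ l)
    (hl1 : l < 1) (hκ : κ = (1 + l) / (1 - l)) (hc0 : 0 ≤ c) (hc1 : c ≤ 1) {n : ℕ} (hn : 1 ≤ n)
    (hsmall : Γ.card *
      (2 * (lpNorm (density ν π) 2 π * Real.exp (-(n * c ^ 2 / (2 * κ))))) < 1) :
    ∃ u : Fin n → Cube s, ∀ C ∈ Γ,
      |(1 / (n : ℝ)) * ∑ i, C.indicator (fun _ => (1 : ℝ)) (drivenPoints φ ψ u i) - π.real C|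
        ≤ c := by
  have hn0 : (0 : ℝ) < n := by exact_mod_cast hn
  set bad : Set G → Set (Fin n → Cube s) := fun C =>
    {u | n * c ≤ ∑ i, centredIndicator π C (drivenPoints φ ψ u i)} with hbad
  set ε := lpNorm (density ν π) 2 π * Real.exp (-(n * c ^ 2 / (2 * κ))) with hε
  have hbound : ∀ C, MeasurableSet C → volume.real (bad C) ≤ ε := fun C hC =>
    measureReal_sum_centredIndicator_ge_le hrev hac hdens hφ hψ hC hl hl0 hl1 hκ hc0 hc1 n
  -- Complements account for deviations below the mean.
  have hU : volume.real (⋃ C ∈ Γ, (bad C ∪ bad Cᶜ)) < 1 := by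
    refine lt_of_le_of_lt ?_ hsmall
    refine (measureReal_biUnion_finset_le _ _).trans ?_
    rw [← nsmul_eq_mul]
    refine Finset.sum_le_card_nsmul _ _ _ fun C hC => ?_
    refine (measureReal_union_le _ _).trans ?_
    linarith [hbound C (hΓ C hC), hbound Cᶜ (hΓ C hC).compl]
  obtain ⟨u, hu⟩ : ∃ u, u ∉ ⋃ C ∈ Γ, (bad C ∪ bad Cᶜ) := by
    by_contra! hall
    rw [Set.eq_univ_of_forall hall, probReal_univ] at hU
    exact lt_irrefl _ hU
  refine ⟨u, fun C hC => ?_⟩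
  simp only [Set.mem_iUnion, Set.mem_union, not_exists, not_or] at hu
  obtain ⟨h1, h2⟩ := hu C hC
  simp only [hbad, Set.mem_ofPred_eq, not_le, centredIndicator_compl (hΓ C hC),
    Finset.sum_neg_distrib] at h1 h2
  rw [average_sub_measureReal hn, abs_mul, abs_of_pos (by positivity), one_div,
    inv_mul_le_iff₀ hn0, abs_le]
  constructor <;> linarith

theorem average_indicator_mono {G : Type*} {n : ℕ} {A B : Set G} (h : A ⊆ B) (x : Fin n → G) :
    (1 / (n : ℝ)) * ∑ i, A.indicator (fun _ => (1 : ℝ)) (x i) ≤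
      (1 / (n : ℝ)) * ∑ i, B.indicator (fun _ => (1 : ℝ)) (x i) :=
  mul_le_mul_of_nonneg_left (Finset.sum_le_sum fun i _ =>
    Set.indicator_le_indicator_of_subset h (fun _ => zero_le_one) (x i)) (by positivity)

/-- Monotonicity sandwiches both the empirical and the true measure of A between those of C and D.
For empty 𝒜 the real supremum is 0, which needs c + δ ≥ 0. -/
theorem starDiscrepancy_le_of_cover {n : ℕ} {𝒜 : Set (Set G)} {Γ : Finset (Set G)} {δ c : ℝ}
    (hδ : 0 ≤ δ) (hc : 0 ≤ c) (hΓ : IsDeltaCover 𝒜 π δ Γ) (x : Fin n → G)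
    (hx : ∀ C ∈ Γ,
      |(1 / (n : ℝ)) * ∑ i, C.indicator (fun _ => (1 : ℝ)) (x i) - π.real C| ≤ c) :
    starDiscrepancy 𝒜 π x ≤ c + δ := by
  refine Real.iSup_le (fun ⟨A, hA⟩ => ?_) (by positivity)
  obtain ⟨C, hC, D, hD, hCA, hAD, hCD⟩ := hΓ.2.2 A hA
  have h1 := abs_le.mp (hx C hC)
  have h2 := abs_le.mp (hx D hD)
  have h3 := average_indicator_mono hCA x
  have h4 := average_indicator_mono hAD x
  have h5 : π.real C ≤ π.real A := measureReal_mono hCA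
  have h6 : π.real A ≤ π.real D := measureReal_mono hAD
  have h7 : π.real D ≤ π.real C + π.real (D \ C) :=
    (measureReal_mono (by rw [Set.union_sdiff_self]; exact Set.subset_union_right)).trans
      (measureReal_union_le _ _)
  simp only
  rw [abs_le]
  constructor <;> linarith [h1.1, h2.2]

theorem abs_average_sub_le_one {n : ℕ} (hn : 1 ≤ n) (A : Set G) (x : Fin n → G) :
    |(1 / (n : ℝ)) * ∑ i, A.indicator (fun _ => (1 : ℝ)) (x i) - π.real A| ≤ 1 := by
  have hn0 : (n : ℝ) ≠ 0 := by positivity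
  have h1 := average_indicator_mono (Set.empty_subset A) x
  have h2 := average_indicator_mono (Set.subset_univ A) x
  simp [hn0] at h1 h2
  have h3 : π.real A ≤ 1 := measureReal_le_one
  have h4 : 0 ≤ π.real A := measureReal_nonneg
  rw [abs_le]
  constructor <;> simp only [one_div] <;> linarith

theorem exists_starDiscrepancy_le (hrev : K.IsReversible π) (hvb : IsVarianceBounding K hrev)
    (hac : ν ≪ π) (hdens : MemLp (density ν π) 2 π) {𝒜 : Set (Set G)} {Γ : Finset (Set G)} {δ : ℝ}
    (hδ : 0 ≤ δ) (hΓ : IsDeltaCover 𝒜 π δ Γ) {φ : G → Cube s → G} (hφ : IsUpdateFunction K φ)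
    {ψ : Cube s → G} (hψ : IsGeneratorFunction ν ψ) {n : ℕ} (hn : 1 ≤ n) :
    ∃ u : Fin n → Cube s, starDiscrepancy 𝒜 π (drivenPoints φ ψ u) ≤
      √((1 + max 0 (spectralSup K hrev)) / (1 - max 0 (spectralSup K hrev))) *
        (√(2 * Real.log ((Γ.card : ℝ) ^ 2 * lpNorm (density ν π) 2 π)) / √(n : ℝ)) + δ := by
  classical
  set l := max 0 (spectralSup K hrev) with hl
  have hl0 : 0 ≤ l := le_max_left _ _
  have hl1 : l < 1 := max_lt one_pos hvb
  set κ := (1 + l) / (1 - l) with hκ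
  have hκ0 : 0 < κ := div_pos (by linarith) (by linarith)
  set M := lpNorm (density ν π) 2 π with hM
  have hM1 : 1 ≤ M := one_le_lpNorm_density hac hdens
  have hg1 : (1 : ℝ) ≤ Γ.card := by
    exact_mod_cast Finset.card_pos.mpr ⟨∅, hΓ.2.1⟩
  set g : ℝ := (Γ.card : ℝ) with hg
  have hgM : 1 ≤ g ^ 2 * M := one_le_mul_of_one_le_of_one_le (one_le_pow₀ hg1) hM1
  set c := √κ * (√(2 * Real.log (g ^ 2 * M)) / √(n : ℝ)) with hc
  have hc0 : 0 ≤ c := by positivity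
  have hn0 : (0 : ℝ) < n := by exact_mod_cast hn
  -- For c > 1 any driver works, because no deviation exceeds 1.
  rcases lt_or_ge 1 c with hc1 | hc1
  · exact ⟨fun _ _ => 0, starDiscrepancy_le_of_cover hδ hc0 hΓ _ fun C _ =>
      (abs_average_sub_le_one hn C _).trans hc1.le⟩
  · have hexp : Real.exp (-(n * c ^ 2 / (2 * κ))) = (g ^ 2 * M)⁻¹ := by
      have : n * c ^ 2 / (2 * κ) = Real.log (g ^ 2 * M) := by
        rw [hc, mul_pow, div_pow, Real.sq_sqrt hκ0.le, Real.sq_sqrt hn0.le,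
          Real.sq_sqrt (mul_nonneg zero_le_two (Real.log_nonneg hgM))]
        field_simp
      rw [this, Real.exp_neg, Real.exp_log (by linarith)]
    have hcard : ((Γ.erase ∅).card : ℝ) = g - 1 := by
      rw [Finset.card_erase_of_mem hΓ.2.1, Nat.cast_sub (Finset.card_pos.mpr ⟨∅, hΓ.2.1⟩)]
      simp [hg]
    -- The empty set has no error, so only g - 1 sets count. The union bound then reads 2(g-1)/g² <
    -- 1, true for every g ≥ 1; keeping ∅ would give 2/g, too large for g ≤ 2.
    obtain ⟨u, hu⟩ := exists_forall_abs_average_sub_le hrev hac hdens hφ hψ (Γ.erase ∅)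
      (fun C hC => hΓ.1 C (Finset.mem_of_mem_erase hC)) (le_max_right 0 _) hl0 hl1 hκ hc0 hc1 hn
      (by
        rw [hexp, hcard, ← hM]
        have : (g - 1) * (2 * (M * (g ^ 2 * M)⁻¹)) = 2 * (g - 1) / g ^ 2 := by
          have : M ≠ 0 := by linarith
          have : g ≠ 0 := by linarith
          field_simp
        rw [this, div_lt_one (by positivity)]
        nlinarith [sq_nonneg (g - 1)])
    refine ⟨u, starDiscrepancy_le_of_cover hδ hc0 hΓ _ fun C hC => ?_⟩
    by_cases h : C = ∅
    · simpa [h] using hc0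
    · exact hu C (Finset.mem_erase.mpr ⟨h, hC⟩)

end DrivenChain

end MCQMC

theorem mainTheorem1 {d : ℕ} (G : Set (EuclideanSpace ℝ (Fin d)))
    (π ν : Measure G) [IsProbabilityMeasure π] [IsProbabilityMeasure ν]
    (K : Kernel G G) [IsMarkovKernel K]
    (hrev : K.IsReversible π) (hvb : MCQMC.IsVarianceBounding K hrev)
    (hac : ν ≪ π) (hdens : MemLp (MCQMC.density ν π) 2 π)
    (𝒜 : Set (Set G)) (h𝒜 : ∀ A ∈ 𝒜, MeasurableSet A)
    (Γ : ℝ → Finset (Set G)) (hΓ : ∀ δ : ℝ, 0 < δ → MCQMC.IsDeltaCover 𝒜 π δ (Γ δ))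
    {s : ℕ} (φ : G → MCQMC.Cube s → G) (hφ : MCQMC.IsUpdateFunction K φ)
    (ψ : MCQMC.Cube s → G) (hψ : MCQMC.IsGeneratorFunction ν ψ)
    (n : ℕ) (hn : 1 ≤ n) (δ : ℝ) (hδ : 0 < δ) :
    ∃ u : Fin n → MCQMC.Cube s,
      MCQMC.starDiscrepancy 𝒜 π (MCQMC.drivenPoints φ ψ u) ≤
        √((1 + max 0 (MCQMC.spectralSup K hrev)) / (1 - max 0 (MCQMC.spectralSup K hrev))) *
          (√(2 * Real.log (((Γ δ).card : ℝ) ^ 2 * lpNorm (MCQMC.density ν π) 2 π)) / √(n : ℝ)) +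
        δ := by
  exact MCQMC.exists_starDiscrepancy_le hrev hvb hac hdens hδ.le (hΓ δ hδ) hφ hψ hn
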